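/- Let $\mathbf k$ be a field of characteristic $0$. For $\mathbb Z$-graded vector spaces $V=\bigoplus_i V_i$ and $W=\bigoplus_i W_i$ let $C^n(V,W)$ be the space of formal sums $f=\sum_{k\ge 1} f_k$ of degree $n$ linear maps $f_k:V^{\otimes k}\to W$. On $\bigoplus_{n\in\mathbb Z} C^n(V,V)$ consider the bilinear bracket given, for $\mu\in C^m(V,V)$ and $\nu\in C^n(V,V)$, by $[\mu,\nu]=\mu\diamond\nu-(-1)^{mn}\,\nu\diamond\mu$, where for $p\ge 1$ and homogeneous $a_1,\dots,a_p$ $$(\mu\diamond\nu)_p(a_1,\dots,a_p)=\sum_{k+l=p+1}\ \sum_{i=1}^{k}(-1)^{n(|a_1|+\cdots+|a_{i-1}|)}\,\mu_k\big(a_1,\dots,a_{i-1},\nu_l(a_i,\dots,a_{i+l-1}),a_{i+l},\dots,a_p\big),$$ and $\nu\diamond\mu$ is defined in the same way, with $m$ in place of $n$ in the sign. Let $(\mathfrak A,\{\mu_k\}_{k\ge1})$ be an $A_\infty$-algebra, that is, $\mathfrak A$ is a $\mathbb Z$-graded vector space and the $\mu_k:\mathfrak A^{\otimes k}\to\mathfrak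 A$ are linear maps of degree $-1$ such that for all $n\ge1$ and homogeneous $a_1,\dots,a_n$ $$\sum_{k+l=n+1}\ \sum_{i=1}^{k}(-1)^{|a_1|+\cdots+|a_{i-1}|}\mu_k\big(a_1,\dots,a_{i-1},\mu_l(a_i,\dots,a_{i+l-1}),a_{i+l},\dots,a_n\big)=0 .$$ Let $\overline{\mathfrak A}$ be another copy of $\mathfrak A$, let $\mathcal G=\bigoplus_n C^n(\overline{\mathfrak A}\oplus\mathfrak A,\overline{\mathfrak A}\oplus\mathfrak A)$ with the bracket above, and let $\mathcal H=\bigoplus_n C^n(\overline{\mathfrak A},\mathfrak A)$, a graded subspace of $\mathcal G$ (a map is extended by zero and followed by the inclusion of $\mathfrak A$). Let $P:\mathcal G\to\mathcal H$ be the projection that restricts a map to $\overline{\mathfrak A}^{\otimes k}$ and projects its value to $\mathfrak A$. Let $\pi=\sum_k\widetilde{\mu_k}\in\mathcal G$ be the element of degree $-1$ given by $$\widetilde{\mu_k}\big((\overline{a_1},x_1),\dots,(\overline{a_k},x_k)\big)=\Big(\overline{\mu_k(a_1,\dots,a_k)},\ \sum_{p=1}^k\sum_{1\le i_1<\cdots<i_p\le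 k}\mu_k(a_1,\dots,x_{i_1},\dots,x_{i_p},\dots,a_k)\Big).$$ Then the maps $$l_k(f_1,\dots,f_k)=P[\cdots[[\pi,f_1],f_2],\dots,f_k],\qquad k\ge1,\ f_1,\dots,f_k\in\mathcal H,$$ make $\mathcal H$ an $L_\infty$-algebra: each $l_k:\mathcal H^{\otimes k}\to\mathcal H$ is linear, graded symmetric and of degree $-1$, and for all $n\ge1$ and homogeneous $f_1,\dots,f_n\in\mathcal H$ $$\sum_{i+j=n+1}\ \sum_{\sigma}\epsilon(\sigma)\,l_j\big(l_i(f_{\sigma(1)},\dots,f_{\sigma(i)}),f_{\sigma(i+1)},\dots,f_{\sigma(n)}\big)=0,$$ where $\sigma$ runs over the $(i,n-i)$-shuffles and $\epsilon(\sigma)=\epsilon(\sigma;f_1,\dots,f_n)$ is the Koszul sign. This $L_\infty$-algebra is weakly filtered by arity: for all $k\ge 1$ and $f_1,\dots,f_k\in\mathcal H$, the component of $l_k(f_1,\dots,f_k)$ on $\overline{\mathfrak A}^{\otimes p}$ vanishes for every $p<k$. -/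

import Mathlib

open scoped DirectSum

namespace DiffAInf

universe u v w v' w'

/-- The total space `⨁ i, V i` of a `ℤ`-graded vector space `V`. -/
abbrev Tot (V : ℤ → Type v) [∀ i, AddCommGroup (V i)] : Type v := ⨁ i, V i

section Graded

variable (K : Type u) [Field K]
variable (V : ℤ → Type v) [∀ i, AddCommGroup (V i)] [∀ i, Module K (V i)]
variable (W : ℤ → Type w) [∀ i, AddCommGroup (W i)] [∀ i, Module K (W i)]

/-- The homogeneous elements of degree `n` in the total space. -/
def homog (n : ℤ) : Submodule K (Tot V) := LinearMap.range (DirectSum.lof K ℤ V n)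

/-- Formal sums `∑_{k ≥ 1} φ_k` of multilinear maps `φ_k : V^{⊗ k} → W`.
The component of arity `k + 1` is stored at the index `k`. -/
abbrev Fam : Type (max v w) :=
  ∀ k : ℕ, MultilinearMap K (fun _ : Fin (k + 1) => Tot V) (Tot W)

/-- `C^n(V, W) = Hom^n(T̄(V), W)`: the formal sums all of whose components have degree `n`. -/
def cochain (n : ℤ) : Submodule K (Fam K V W) where
  carrier := {φ | ∀ (k : ℕ) (d : Fin (k + 1) → ℤ) (a : Fin (k + 1) → Tot V),
    (∀ i, a i ∈ homog K V (d i)) → φ k a ∈ homog K W ((∑ i, d i) + n)}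
  add_mem' hφ hψ k d a ha := (homog K W _).add_mem (hφ k d a ha) (hψ k d a ha)
  zero_mem' _ _ _ _ := (homog K W _).zero_mem
  smul_mem' c _ hφ k d a ha := (homog K W _).smul_mem c (hφ k d a ha)

/-- The graded vector space `⨁ n, C^n(V, W)`. -/
abbrev Cochains : Type (max v w) := ⨁ n : ℤ, cochain K V W n

/-- The operator `a ↦ (-1)^{m |a|} a` (for homogeneous `a`) on the total space. -/
def koszul (m : ℤ) : Tot V →ₗ[K] Tot V :=
  DirectSum.lmap (fun i => (m * i).negOnePow • (LinearMap.id : V i →ₗ[K] V i))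

theorem koszul_mem_homog (m n : ℤ) {a : Tot V} (ha : a ∈ homog K V n) :
    koszul K V m a ∈ homog K V n := by
  obtain ⟨x, rfl⟩ := ha
  exact ⟨_, (DirectSum.lmap_lof _ _ _).symm⟩

end Graded

section Insertion

/-- The list `(a_1, …, a_{i-1}, ν(a_i, …, a_{i+l}), a_{i+l+1}, …, a_{p+1})` of length `k + 1`
obtained by applying `ν`, of arity `l + 1`, to `l + 1` consecutive entries of a list of length
`p + 1 = k + l + 1`; the position `i` is counted from `0` in the code. -/
def insertArgs {X : Type v} {k l p : ℕ} (h : k + l = p) (i : Fin (k + 1))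
    (ν : (Fin (l + 1) → X) → X) (a : Fin (p + 1) → X) : Fin (k + 1) → X := fun j =>
  if j < i then a ⟨j, by omega⟩
  else if j = i then ν (fun t => a ⟨i + t, by omega⟩)
  else a ⟨j + l, by omega⟩

variable {K : Type u} [Field K] {X : Type v} [AddCommGroup X] [Module K X]

theorem insertArgs_update {k l p : ℕ} (h : k + l = p) (i : Fin (k + 1))
    (ν : MultilinearMap K (fun _ : Fin (l + 1) => X) X) (a : Fin (p + 1) → X) (s : Fin (p + 1)) :
    ∃ (j : Fin (k + 1)) (L : X →ₗ[K] X), ∀ x, insertArgs h i ν (Function.update a s x) =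
      Function.update (insertArgs h i ν a) j (L x) := by
  have key : ∀ (x : X) (n : ℕ) (hn : n < p + 1), n ≠ s.val →
      Function.update a s x ⟨n, hn⟩ = a ⟨n, hn⟩ := fun x n hn hne =>
    Function.update_of_ne (fun e => hne (congrArg Fin.val e)) _ _
  have key' : ∀ (x : X) (n : ℕ) (hn : n < p + 1), n = s.val →
      Function.update a s x ⟨n, hn⟩ = x := by
    rintro x n hn rfl
    simp
  by_cases h1 : s.val < i.val
  · refine ⟨⟨s, by omega⟩, LinearMap.id, fun x => funext fun j => ?_⟩
    by_cases hj : j = ⟨s.val, by omega⟩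
    · subst hj
      simp [insertArgs, Fin.lt_def, h1]
    · have hj' : j.val ≠ s.val := fun e => hj (Fin.ext e)
      rw [Function.update_of_ne hj]
      unfold insertArgs
      split_ifs with h2 h3
      · exact key _ _ _ hj'
      · congr 1
        funext t
        exact key _ _ _ (by omega)
      · refine key _ _ _ ?_
        simp only [Fin.lt_def, Fin.ext_iff] at h2 h3
        omega
  by_cases h2 : s.val ≤ i.val + l
  · refine ⟨i, ν.toLinearMap (fun t => a ⟨i + t, by omega⟩) ⟨s - i, by omega⟩,
      fun x => funext fun j => ?_⟩
    by_cases hj : j = i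
    · subst hj
      simp only [insertArgs, lt_irrefl, if_false, if_true, Function.update_self,
        MultilinearMap.toLinearMap_apply]
      congr 1
      funext t
      by_cases ht : t.val = s.val - j.val
      · rw [key' _ _ _ (by omega)]
        have e : t = ⟨s - j, by omega⟩ := Fin.ext ht
        rw [← e, Function.update_self]
      · rw [key _ _ _ (by omega), Function.update_of_ne (fun e => ht (congrArg Fin.val e))]
    · rw [Function.update_of_ne hj]
      unfold insertArgs
      have hj' : j.val ≠ i.val := fun e => hj (Fin.ext e)
      split_ifs with h3
      · simp only [Fin.lt_def] at h3
        exact key _ _ _ (by omega)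
      · simp only [Fin.lt_def] at h3
        exact key _ _ _ (by omega)
  · refine ⟨⟨s - l, by omega⟩, LinearMap.id, fun x => funext fun j => ?_⟩
    by_cases hj : j = ⟨s.val - l, by omega⟩
    · subst hj
      have e1 : ¬ ((⟨s.val - l, by omega⟩ : Fin (k + 1)) < i) := by
        simp only [Fin.lt_def]; omega
      have e2 : ¬ ((⟨s.val - l, by omega⟩ : Fin (k + 1)) = i) := by
        simp only [Fin.ext_iff]; omega
      simp only [insertArgs, if_neg e1, if_neg e2, Function.update_self, LinearMap.id_apply]
      exact key' _ _ _ (by omega)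
    · have hj' : j.val ≠ s.val - l := fun e => hj (Fin.ext e)
      rw [Function.update_of_ne hj]
      unfold insertArgs
      split_ifs with h3 h4
      · simp only [Fin.lt_def] at h3
        exact key _ _ _ (by omega)
      · congr 1
        funext t
        exact key _ _ _ (by omega)
      · exact key _ _ _ (by omega)

/-- The partial composition
`(a_1, …, a_{p+1}) ↦ μ(a_1, …, a_{i-1}, ν(a_i, …, a_{i+l}), a_{i+l+1}, …, a_{p+1})`, with no sign. -/
def insertMap {k l p : ℕ} (h : k + l = p) (i : Fin (k + 1))
    (μ : MultilinearMap K (fun _ : Fin (k + 1) => X) X)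
    (ν : MultilinearMap K (fun _ : Fin (l + 1) => X) X) :
    MultilinearMap K (fun _ : Fin (p + 1) => X) X :=
  MultilinearMap.mk' (fun a => μ (insertArgs h i ν a))
    (fun a s x y => by
      obtain ⟨j, L, hL⟩ := insertArgs_update h i ν a s
      simp [hL])
    (fun a s c x => by
      obtain ⟨j, L, hL⟩ := insertArgs_update h i ν a s
      simp [hL])

theorem insertMap_apply {k l p : ℕ} (h : k + l = p) (i : Fin (k + 1))
    (μ : MultilinearMap K (fun _ : Fin (k + 1) => X) X)
    (ν : MultilinearMap K (fun _ : Fin (l + 1) => X) X) (a : Fin (p + 1) → X) :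
    insertMap h i μ ν a = μ (insertArgs h i ν a) := rfl

theorem insertArgs_eq_update {k l p : ℕ} (h : k + l = p) (i : Fin (k + 1))
    (ν : (Fin (l + 1) → X) → X) (a : Fin (p + 1) → X) :
    insertArgs h i ν a = Function.update (insertArgs h i (fun _ => 0) a) i
      (ν (fun t => a ⟨i + t, by omega⟩)) := by
  funext j
  by_cases hj : j = i
  · subst hj
    simp [insertArgs]
  · simp [insertArgs, hj]

theorem insertMap_add_left {k l p : ℕ} (h : k + l = p) (i : Fin (k + 1))
    (μ μ' : MultilinearMap K (fun _ : Fin (k + 1) => X) X)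
    (ν : MultilinearMap K (fun _ : Fin (l + 1) => X) X) :
    insertMap h i (μ + μ') ν = insertMap h i μ ν + insertMap h i μ' ν := rfl

theorem insertMap_smul_left {k l p : ℕ} (h : k + l = p) (i : Fin (k + 1)) (c : K)
    (μ : MultilinearMap K (fun _ : Fin (k + 1) => X) X)
    (ν : MultilinearMap K (fun _ : Fin (l + 1) => X) X) :
    insertMap h i (c • μ) ν = c • insertMap h i μ ν := rfl

theorem insertMap_add_right {k l p : ℕ} (h : k + l = p) (i : Fin (k + 1))
    (μ : MultilinearMap K (fun _ : Fin (k + 1) => X) X)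
    (ν ν' : MultilinearMap K (fun _ : Fin (l + 1) => X) X) :
    insertMap h i μ (ν + ν') = insertMap h i μ ν + insertMap h i μ ν' :=
  MultilinearMap.ext fun a => by
    rw [add_apply, insertMap_apply, insertMap_apply, insertMap_apply,
      insertArgs_eq_update h i (⇑(ν + ν')), insertArgs_eq_update h i (⇑ν),
      insertArgs_eq_update h i (⇑ν'), add_apply, MultilinearMap.map_update_add]

theorem insertMap_smul_right {k l p : ℕ} (h : k + l = p) (i : Fin (k + 1)) (c : K)
    (μ : MultilinearMap K (fun _ : Fin (k + 1) => X) X)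
    (ν : MultilinearMap K (fun _ : Fin (l + 1) => X) X) :
    insertMap h i μ (c • ν) = c • insertMap h i μ ν :=
  MultilinearMap.ext fun a => by
    rw [smul_apply, insertMap_apply, insertMap_apply,
      insertArgs_eq_update h i (⇑(c • ν)), insertArgs_eq_update h i (⇑ν),
      smul_apply, MultilinearMap.map_update_smul]

theorem sum_insertArgs {k l p : ℕ} (h : k + l = p) (i : Fin (k + 1)) (n : ℤ)
    (d : Fin (p + 1) → ℤ) :
    ∑ j, insertArgs h i (fun e => (∑ t, e t) + n) d j = (∑ s, d s) + n := by
  obtain ⟨i, hi⟩ := i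
  obtain ⟨r, rfl⟩ : ∃ r, k = i + r := ⟨k - i, by omega⟩
  set d' : ℕ → ℤ := fun s => if hs : s < p + 1 then d ⟨s, hs⟩ else 0 with hd'
  have hd : ∀ s (hs : s < p + 1), d ⟨s, hs⟩ = d' s := fun s hs => by
    simp only [hd', dif_pos hs]
  have hR : ∑ s, d s = ∑ s ∈ Finset.range (p + 1), d' s := by
    rw [← Fin.sum_univ_eq_sum_range]
    exact Finset.sum_congr rfl fun s _ => hd s.1 s.2
  set e : ℕ → ℤ := fun j => if j < i then d' j
    else if j = i then (∑ t ∈ Finset.range (l + 1), d' (i + t)) + n else d' (j + l) with he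
  have hL : ∑ j, insertArgs h ⟨i, hi⟩ (fun e => (∑ t, e t) + n) d j =
      ∑ j ∈ Finset.range (i + r + 1), e j := by
    rw [← Fin.sum_univ_eq_sum_range]
    refine Finset.sum_congr rfl fun j _ => ?_
    simp only [insertArgs, he, Fin.lt_def, Fin.ext_iff, hd,
      ← Fin.sum_univ_eq_sum_range (fun t => d' (i + t)) (l + 1)]
  have e1 : ∑ j ∈ Finset.range i, e j = ∑ j ∈ Finset.range i, d' j :=
    Finset.sum_congr rfl fun j hj => by simp [he, Finset.mem_range.1 hj]
  have e2 : ∑ j ∈ Finset.range r, e (i + 1 + j) =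
      ∑ j ∈ Finset.range r, d' (i + (l + 1) + j) :=
    Finset.sum_congr rfl fun j _ => by
      have q1 : ¬ (i + 1 + j < i) := by omega
      have q2 : ¬ (i + 1 + j = i) := by omega
      simp only [he, if_neg q1, if_neg q2]
      congr 1
      omega
  have e3 : e i = (∑ t ∈ Finset.range (l + 1), d' (i + t)) + n := by simp [he]
  rw [hL, hR, show i + r + 1 = i + 1 + r by omega, show p + 1 = i + (l + 1) + r by omega,
    Finset.sum_range_add, Finset.sum_range_succ, Finset.sum_range_add _ (i + (l + 1)) r,
    Finset.sum_range_add _ i (l + 1), e1, e2, e3]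
  ring

end Insertion

section Bracket

variable (K : Type u) [Field K]
variable (V : ℤ → Type v) [∀ i, AddCommGroup (V i)] [∀ i, Module K (V i)]

/-- The map `μ ⋄ ν`, for `ν` of degree `n`, with component of arity `p + 1`
`∑ (-1)^{n (|a_1| + ⋯ + |a_{i-1}|)} μ_k(a_1, …, a_{i-1}, ν_l(a_i, …), …, a_{p+1})`,
the sum being over the positions `i` and the arities `k, l ≥ 1` with `k + l = p + 2`. -/
def diamond (n : ℤ) (μ ν : Fam K V V) : Fam K V V := fun p =>
  ∑ x : Finset.HasAntidiagonal.antidiagonal p, ∑ i : Fin (x.1.1 + 1),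
    (insertMap (Finset.HasAntidiagonal.mem_antidiagonal.1 x.2) i (μ x.1.1) (ν x.1.2)).compLinearMap
      (fun t : Fin (p + 1) => if t.val < i.val then koszul K V n else LinearMap.id)

variable {K V}

theorem insertMap_mem {m n : ℤ} {μ ν : Fam K V V} (hμ : μ ∈ cochain K V V m)
    (hν : ν ∈ cochain K V V n) {k l p : ℕ} (h : k + l = p) (i : Fin (k + 1))
    (d : Fin (p + 1) → ℤ) (a : Fin (p + 1) → Tot V) (ha : ∀ s, a s ∈ homog K V (d s)) :
    insertMap h i (μ k) (ν l) a ∈ homog K V ((∑ s, d s) + (m + n)) := by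
  have := hμ k (insertArgs h i (fun e => (∑ t, e t) + n) d) (insertArgs h i (ν l) a) (by
    intro j
    unfold insertArgs
    split_ifs
    · exact ha _
    · exact hν _ _ _ fun t => ha _
    · exact ha _)
  rw [sum_insertArgs] at this
  rw [add_comm m n, ← add_assoc]
  exact this

theorem diamond_mem {m n : ℤ} {μ ν : Fam K V V} (hμ : μ ∈ cochain K V V m)
    (hν : ν ∈ cochain K V V n) : diamond K V n μ ν ∈ cochain K V V (m + n) := by
  intro p d a ha
  simp only [diamond, sum_apply]
  refine Submodule.sum_mem _ fun x _ => Submodule.sum_mem _ fun i _ => ?_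
  refine insertMap_mem hμ hν _ i d _ fun s => ?_
  dsimp only
  split_ifs
  · exact koszul_mem_homog K V n _ (ha s)
  · exact ha s

theorem diamond_add_left (n : ℤ) (μ μ' ν : Fam K V V) :
    diamond K V n (μ + μ') ν = diamond K V n μ ν + diamond K V n μ' ν := by
  funext p
  simp only [diamond, Pi.add_apply, ← Finset.sum_add_distrib, insertMap_add_left]
  rfl

theorem diamond_smul_left (n : ℤ) (c : K) (μ ν : Fam K V V) :
    diamond K V n (c • μ) ν = c • diamond K V n μ ν := by
  funext p
  simp only [diamond, Pi.smul_apply, Finset.smul_sum, insertMap_smul_left]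
  rfl

theorem diamond_add_right (n : ℤ) (μ ν ν' : Fam K V V) :
    diamond K V n μ (ν + ν') = diamond K V n μ ν + diamond K V n μ ν' := by
  funext p
  simp only [diamond, Pi.add_apply, ← Finset.sum_add_distrib, insertMap_add_right]
  rfl

theorem diamond_smul_right (n : ℤ) (c : K) (μ ν : Fam K V V) :
    diamond K V n μ (c • ν) = c • diamond K V n μ ν := by
  funext p
  simp only [diamond, Pi.smul_apply, Finset.smul_sum, insertMap_smul_right]
  rfl

variable (K V)

/-- The bracket `⟦μ, ν⟧ = μ ⋄ ν - (-1)^{m n} ν ⋄ μ` of `μ` in `C^m(V, V)` and `ν` in `C^n(V, V)`. -/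
def bracketHom (m n : ℤ) :
    cochain K V V m →ₗ[K] cochain K V V n →ₗ[K] cochain K V V (m + n) :=
  LinearMap.mk₂ K
    (fun μ ν => ⟨diamond K V n μ ν - (m * n).negOnePow • diamond K V m ν μ,
      Submodule.sub_mem _ (diamond_mem μ.2 ν.2) (by
        have := diamond_mem ν.2 μ.2
        rw [add_comm n m] at this
        rcases Int.units_eq_one_or (m * n).negOnePow with e | e <;> rw [e] <;>
          simpa [Units.smul_def] using this)⟩)
    (fun μ μ' ν => Subtype.ext (by
      simp only [Submodule.coe_add, diamond_add_left, diamond_add_right, smul_add]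
      abel))
    (fun c μ ν => Subtype.ext (by
      simp only [Submodule.coe_smul, diamond_smul_left, diamond_smul_right, smul_sub]
      rw [smul_comm]))
    (fun μ ν ν' => Subtype.ext (by
      simp only [Submodule.coe_add, diamond_add_left, diamond_add_right, smul_add]
      abel))
    (fun c μ ν => Subtype.ext (by
      simp only [Submodule.coe_smul, diamond_smul_left, diamond_smul_right, smul_sub]
      rw [smul_comm]))

/-- The bracket on `⨁ n, C^n(V, V)`, the bilinear extension of the bracket of homogeneous
cochains. -/
def bracket : Cochains K V V →ₗ[K] Cochains K V V →ₗ[K] Cochains K V V :=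
  DirectSum.toModule K ℤ _ fun m =>
    (DirectSum.toModule K ℤ (cochain K V V m →ₗ[K] Cochains K V V) fun n =>
      ((bracketHom K V m n).compr₂
        (DirectSum.lof K ℤ (fun r => cochain K V V r) (m + n))).flip).flip

theorem bracket_lof (m n : ℤ) (μ : cochain K V V m) (ν : cochain K V V n) :
    bracket K V (DirectSum.lof K ℤ _ m μ) (DirectSum.lof K ℤ _ n ν) =
      DirectSum.lof K ℤ (fun r => cochain K V V r) (m + n) (bracketHom K V m n μ ν) := by
  simp [bracket]

end Bracket

section Functoriality

variable (K : Type u) [Field K]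
variable {V : ℤ → Type v} [∀ i, AddCommGroup (V i)] [∀ i, Module K (V i)]
variable {V' : ℤ → Type v'} [∀ i, AddCommGroup (V' i)] [∀ i, Module K (V' i)]
variable {W : ℤ → Type w} [∀ i, AddCommGroup (W i)] [∀ i, Module K (W i)]
variable {W' : ℤ → Type w'} [∀ i, AddCommGroup (W' i)] [∀ i, Module K (W' i)]

theorem lmap_mem_homog (φ : ∀ i, V i →ₗ[K] V' i) {n : ℤ} {a : Tot V} (ha : a ∈ homog K V n) :
    DirectSum.lmap φ a ∈ homog K V' n := by
  obtain ⟨x, rfl⟩ := ha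
  exact ⟨_, (DirectSum.lmap_lof _ _ _).symm⟩

/-- For linear maps `φ : V' → V` and `ψ : W → W'` of degree `0`, the map
`f ↦ ψ ∘ f ∘ (φ ⊗ ⋯ ⊗ φ)` from `C^n(V, W)` to `C^n(V', W')`. -/
def cochainMap (φ : ∀ i, V' i →ₗ[K] V i) (ψ : ∀ i, W i →ₗ[K] W' i) (n : ℤ) :
    cochain K V W n →ₗ[K] cochain K V' W' n where
  toFun f := ⟨fun k => (DirectSum.lmap ψ).compMultilinearMap
      ((f.1 k).compLinearMap fun _ => DirectSum.lmap φ),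
    fun k d _ ha => lmap_mem_homog K ψ (f.2 k d _ fun i => lmap_mem_homog K φ (ha i))⟩
  map_add' f g := Subtype.ext (funext fun k => MultilinearMap.ext fun a => by simp)
  map_smul' c f := Subtype.ext (funext fun k => MultilinearMap.ext fun a => by simp)

end Functoriality

section AInfinity

variable (K : Type u) [Field K]
variable (V : ℤ → Type v) [∀ i, AddCommGroup (V i)] [∀ i, Module K (V i)]

/-- An `A_∞`-algebra structure on the graded vector space `V`: maps `μ_k : V^{⊗ k} → V`, `k ≥ 1`, of
degree `-1` satisfying the higher associativity relations on homogeneous elements. -/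
structure AInfinityStructure where
  /-- The structure maps; `μ_{k + 1}` is stored at the index `k`. -/
  μ : cochain K V V (-1)
  /-- The relation with `p + 1` arguments. -/
  relation : ∀ (p : ℕ) (d : Fin (p + 1) → ℤ) (a : Fin (p + 1) → Tot V),
    (∀ s, a s ∈ homog K V (d s)) →
      ∑ x : Finset.HasAntidiagonal.antidiagonal p, ∑ i : Fin (x.1.1 + 1),
        (∑ s : Fin (p + 1) with s.val < i.val, d s).negOnePow •
          insertMap (Finset.HasAntidiagonal.mem_antidiagonal.1 x.2) i (μ.1 x.1.1) (μ.1 x.1.2) a = 0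

/-- The graded vector space `V̄ ⊕ V`, where `V̄` is another copy of `V`. -/
abbrev Double (i : ℤ) : Type v := V i × V i

variable {K V}

/-- The maps `μ̃_k` on `V̄ ⊕ V` with
`μ̃_k((ā_1, x_1), …, (ā_k, x_k)) = (μ_k(a_1, …, a_k), ∑_S μ_k(…))`, the sum being over the nonempty
sets `S` of positions, with `x_i` inserted at the positions `i` in `S` and `a_i` at the others. -/
def doubleFam (μ : Fam K V V) : Fam K (Double V) (Double V) := fun k =>
  (DirectSum.lmap fun i => LinearMap.inl K (V i) (V i)).compMultilinearMap
      ((μ k).compLinearMap fun _ => DirectSum.lmap fun i => LinearMap.fst K (V i) (V i)) +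
    (DirectSum.lmap fun i => LinearMap.inr K (V i) (V i)).compMultilinearMap
      (∑ S : Finset (Fin (k + 1)) with S.Nonempty,
        (μ k).compLinearMap fun s =>
          if s ∈ S then DirectSum.lmap fun i => LinearMap.snd K (V i) (V i)
          else DirectSum.lmap fun i => LinearMap.fst K (V i) (V i))

theorem doubleFam_mem {μ : Fam K V V} {n : ℤ} (hμ : μ ∈ cochain K V V n) :
    doubleFam μ ∈ cochain K (Double V) (Double V) n := by
  intro k d a ha
  refine Submodule.add_mem _ (lmap_mem_homog K _ (hμ k d _ fun i => lmap_mem_homog K _ (ha i)))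
    (lmap_mem_homog K _ ?_)
  rw [sum_apply]
  refine Submodule.sum_mem _ fun S _ => hμ k d _ fun s => ?_
  dsimp only
  split_ifs
  · exact lmap_mem_homog K _ (ha s)
  · exact lmap_mem_homog K _ (ha s)

variable (K V)

/-- The graded Lie algebra `𝒢 = ⨁ n, C^n(V̄ ⊕ V, V̄ ⊕ V)`; its bracket is `bracket K (Double V)`. -/
abbrev GSpace : Type v := Cochains K (Double V) (Double V)

/-- The graded vector space `ℋ = ⨁ n, C^n(V̄, V)`. -/
abbrev HSpace : Type v := Cochains K V V

/-- The inclusion of `ℋ` in `𝒢`: a map `V̄^{⊗ k} → V` is extended by zero to `(V̄ ⊕ V)^{⊗ k}` and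
followed by the inclusion of `V`. -/
def incl : HSpace K V →ₗ[K] GSpace K V :=
  DirectSum.lmap fun n => cochainMap K (V := V) (V' := Double V) (W := V) (W' := Double V)
    (fun i => LinearMap.fst K (V i) (V i)) (fun i => LinearMap.inr K (V i) (V i)) n

/-- The projection `P` of `𝒢` onto `ℋ`: a map is restricted to `V̄^{⊗ k}` and its value is projected
to `V`. -/
def proj : GSpace K V →ₗ[K] HSpace K V :=
  DirectSum.lmap fun n => cochainMap K (V := Double V) (V' := V) (W := Double V) (W' := V)
    (fun i => LinearMap.inl K (V i) (V i)) (fun i => LinearMap.snd K (V i) (V i)) n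

variable {K V}

/-- The element `π = ∑_k μ̃_k` of `C^{-1}(V̄ ⊕ V, V̄ ⊕ V)`. -/
def piElement (A : AInfinityStructure K V) : GSpace K V :=
  DirectSum.lof K ℤ (fun n => cochain K (Double V) (Double V) n) (-1)
    ⟨doubleFam A.μ.1, doubleFam_mem A.μ.2⟩

/-- The iterated bracket `[⋯[[π, f_1], f_2], …, f_k]` in `𝒢`. -/
def iterBracket (A : AInfinityStructure K V) : ∀ k : ℕ, (Fin k → HSpace K V) → GSpace K V
  | 0, _ => piElement A
  | k + 1, f => bracket K (Double V) (iterBracket A k fun i => f i.castSucc)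
      (incl K V (f (Fin.last k)))

end AInfinity

section LInfinity

/-- The Koszul sign `ε(σ; x_1, …, x_n)` for homogeneous `x_s` of degree `d s`: one factor
`(-1)^{|x_a| |x_b|}` for each pair whose order is reversed in `(x_{σ(1)}, …, x_{σ(n)})`. -/
def koszulSign {n : ℕ} (σ : Equiv.Perm (Fin n)) (d : Fin n → ℤ) : ℤˣ :=
  ∏ q : Fin n × Fin n with q.1 < q.2 ∧ σ q.2 < σ q.1, (d (σ q.1) * d (σ q.2)).negOnePow

/-- `σ` is an `(i, n - i)`-shuffle: `σ(1) < ⋯ < σ(i)` and `σ(i + 1) < ⋯ < σ(n)`. -/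
def IsShuffle {n : ℕ} (i : ℕ) (σ : Equiv.Perm (Fin n)) : Prop :=
  ∀ s t : Fin n, s < t → (t.val < i ∨ i ≤ s.val) → σ s < σ t

variable (K : Type u) [Field K]
variable (L : ℤ → Type v) [∀ i, AddCommGroup (L i)] [∀ i, Module K (L i)]

open Classical in
/-- `(L, {l_k})` is an `L_∞`-algebra, with all brackets graded symmetric of degree `-1`;
`l_{k + 1}` is stored at the index `k`. -/
structure IsLInfinityAlgebra (l : Fam K L L) : Prop where
  degree : l ∈ cochain K L L (-1)
  symmetric : ∀ (k : ℕ) (σ : Equiv.Perm (Fin (k + 1))) (d : Fin (k + 1) → ℤ)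
    (x : Fin (k + 1) → Tot L), (∀ s, x s ∈ homog K L (d s)) →
      l k (fun s => x (σ s)) = koszulSign σ d • l k x
  /-- The relation with `p + 1` arguments: the sum over `i + j = p + 2` and `(i, p + 1 - i)`-shuffles
  of `ε(σ) l_j(l_i(x_{σ(1)}, …, x_{σ(i)}), x_{σ(i + 1)}, …, x_{σ(p + 1)})`, where `j = y.1.1 + 1` and
  `i = y.1.2 + 1` in the code. -/
  jacobi : ∀ (p : ℕ) (d : Fin (p + 1) → ℤ) (x : Fin (p + 1) → Tot L),
    (∀ s, x s ∈ homog K L (d s)) →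
      ∑ y : Finset.HasAntidiagonal.antidiagonal p,
        ∑ σ : Equiv.Perm (Fin (p + 1)) with IsShuffle (y.1.2 + 1) σ,
          koszulSign σ d •
            insertMap (Finset.HasAntidiagonal.mem_antidiagonal.1 y.2) 0 (l y.1.1) (l y.1.2)
              (fun s => x (σ s)) = 0

end LInfinity

end DiffAInf

/-!
The operation `⋄` has a symmetric associator, because inserting two maps at disjoint places commutes
up to the Koszul sign, so it is a graded pre-Lie product and its commutator is a graded Lie bracket.
The kernel of `P` is closed under this bracket (it consists of the maps that send arguments in `V̄`
to values in `V̄`), `ℋ` is abelian, `P π = 0` and `[π, [π, ·]] = 0`: these are Voronov's V-data.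

The last identity is expanded by the Leibniz rule: for homogeneous `f₁, …, f_n` in `ℋ`, applying
`[·, f₂], …, [·, f_n]` to `[π, [π, f₁]] = 0` gives a sum over the subsets `S` of `{2, …, n}` of
brackets of a nested bracket of `π` with the `f_s`, `s ∉ S`, and one of `π` with `f₁` and the `f_s`,
`s ∈ S`. After projecting, and replacing each factor by its `P`-component, this becomes the sum of
the `L_∞` relation over all subsets of the arguments. Starting from `[π, [π, f₁]]` rather than from
`[π, π] = 0` avoids a division by `2`.

For the arity statement, filter `V̄ ⊕ V` by `0 ⊆ V ⊆ V̄ ⊕ V`. The element `π` preserves this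
filtration and an element of `ℋ` lowers it by one, so `[⋯[π, f₁], ⋯, f_k]` lowers it by `k`. For
`p < k` it vanishes on `V̄^{⊗ p}`, whose elements have filtration degree `p`.
-/

namespace DiffAInf

universe u v w v' w'

section Homogeneous

variable {K : Type u} [Field K]
variable {V : ℤ → Type v} [∀ i, AddCommGroup (V i)] [∀ i, Module K (V i)]
variable {V' : ℤ → Type v'} [∀ i, AddCommGroup (V' i)] [∀ i, Module K (V' i)]

theorem negOnePow_sum {ι : Type*} (s : Finset ι) (d : ι → ℤ) :
    (∑ i ∈ s, d i).negOnePow = ∏ i ∈ s, (d i).negOnePow := by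
  classical
  induction s using Finset.induction_on with
  | empty => simp
  | insert i s hi ih => rw [Finset.sum_insert hi, Finset.prod_insert hi, Int.negOnePow_add, ih]

theorem map_units_smul {ι M N : Type*} [Fintype ι] [AddCommGroup M] [AddCommGroup N]
    [Module K M] [Module K N] (f : MultilinearMap K (fun _ : ι => M) N) (ε : ι → ℤˣ) (a : ι → M) :
    f (fun i => ε i • a i) = (∏ i, ε i) • f a := by
  simp only [Units.smul_def, ← Int.cast_smul_eq_zsmul K, Units.coe_prod, Int.cast_prod]
  exact f.map_smul_univ _ _

theorem koszul_koszul (m n : ℤ) (a : Tot V) :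
    koszul K V m (koszul K V n a) = koszul K V (m + n) a := by
  have : koszul K V m ∘ₗ koszul K V n = koszul K V (m + n) := by
    ext i x : 2
    simp only [koszul, LinearMap.comp_apply, DirectSum.lmap_lof, LinearMap.smul_apply,
      LinearMap.id_apply, smul_smul, add_mul, Int.negOnePow_add]
  exact LinearMap.congr_fun this a

theorem koszul_of_mem_homog (m : ℤ) {n : ℤ} {a : Tot V} (ha : a ∈ homog K V n) :
    koszul K V m a = (m * n).negOnePow • a := by
  obtain ⟨x, rfl⟩ := ha
  rw [koszul, DirectSum.lmap_lof, LinearMap.smul_apply, LinearMap.id_apply,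
    LinearMap.map_smul_of_tower]

theorem lmap_koszul (φ : ∀ i, V' i →ₗ[K] V i) (n : ℤ) (a : Tot V') :
    DirectSum.lmap φ (koszul K V' n a) = koszul K V n (DirectSum.lmap φ a) := by
  have : DirectSum.lmap φ ∘ₗ koszul K V' n = koszul K V n ∘ₗ DirectSum.lmap φ := by
    ext i x : 2
    simp only [koszul, LinearMap.comp_apply, DirectSum.lmap_lof, LinearMap.smul_apply,
      LinearMap.id_apply, LinearMap.map_smul_of_tower]
  exact LinearMap.congr_fun this a

theorem multilinear_ext_homog {N ι : Type*} [Finite ι] [AddCommGroup N] [Module K N]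
    {f g : MultilinearMap K (fun _ : ι => Tot V) N}
    (h : ∀ (d : ι → ℤ) (a : ι → Tot V), (∀ i, a i ∈ homog K V (d i)) → f a = g a) : f = g := by
  refine MultilinearMap.dfinsupp_ext (κ := fun _ : ι => ℤ) (M := fun _ i => V i) fun d => ?_
  exact MultilinearMap.ext fun x => h d _ fun i => ⟨x i, rfl⟩

theorem map_koszul {m : ℤ} {φ : Fam K V V} (hφ : φ ∈ cochain K V V m) (n : ℤ) (k : ℕ)
    (a : Fin (k + 1) → Tot V) :
    φ k (fun t => koszul K V n (a t)) = (m * n).negOnePow • koszul K V n (φ k a) := by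
  have : (φ k).compLinearMap (fun _ => koszul K V n) =
      (m * n).negOnePow • (koszul K V n).compMultilinearMap (φ k) := by
    refine multilinear_ext_homog fun d a ha => ?_
    simp only [MultilinearMap.compLinearMap_apply, smul_apply,
      LinearMap.compMultilinearMap_apply]
    simp only [koszul_of_mem_homog n (hφ k d a ha), fun i => koszul_of_mem_homog n (ha i)]
    rw [map_units_smul, smul_smul, ← negOnePow_sum, ← Finset.mul_sum, mul_add, Int.negOnePow_add,
      mul_comm n m, mul_left_comm, Int.units_mul_self, mul_one]
  exact congrArg (fun f => f a) this

end Homogeneous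

section PreLie

variable {K : Type u} [Field K]
variable {V : ℤ → Type v} [∀ i, AddCommGroup (V i)] [∀ i, Module K (V i)]

/-- The component of arity `k + 1` of `φ`, evaluated on the first `k + 1` entries of a sequence.
Sequences on `ℕ` avoid casts between `Fin`s in iterated insertions. -/
def evalSeq (φ : Fam K V V) (k : ℕ) (a : ℕ → Tot V) : Tot V := φ k fun t => a t

theorem evalSeq_congr (φ : Fam K V V) {k : ℕ} {a b : ℕ → Tot V} (h : ∀ t ≤ k, a t = b t) :
    evalSeq φ k a = evalSeq φ k b :=
  congrArg (φ k) (funext fun t => h t (Nat.lt_succ_iff.1 t.2))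

theorem fam_ext {φ ψ : Fam K V V} (h : ∀ k a, evalSeq φ k a = evalSeq ψ k a) : φ = ψ := by
  funext k
  refine MultilinearMap.ext fun a => ?_
  have := h k (fun j => if hj : j < k + 1 then a ⟨j, hj⟩ else 0)
  simpa only [evalSeq, Fin.is_lt, dite_true, Fin.eta] using this

theorem evalSeq_update (φ : Fam K V V) {k j : ℕ} (hj : j ≤ k) (a : ℕ → Tot V) (x : Tot V) :
    evalSeq φ k (Function.update a j x) =
      (φ k).toLinearMap (fun t => a t) ⟨j, Nat.lt_succ_of_le hj⟩ x := by
  refine congrArg (φ k) (funext fun t => ?_)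
  simp [Function.update_apply, Fin.ext_iff]

theorem evalSeq_koszul {m : ℤ} {φ : Fam K V V} (hφ : φ ∈ cochain K V V m) (n : ℤ) (k : ℕ)
    (a : ℕ → Tot V) :
    evalSeq φ k (fun t => koszul K V n (a t)) =
      (m * n).negOnePow • koszul K V n (evalSeq φ k a) :=
  map_koszul hφ n k _

/-- The sequence obtained from `a` by applying the component of arity `l + 1` of `ν` to the entries
from position `i` on, and the Koszul operator of degree `n` to the entries before. -/
def insertSeq (n : ℤ) (i l : ℕ) (ν : Fam K V V) (a : ℕ → Tot V) : ℕ → Tot V := fun j =>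
  if j < i then koszul K V n (a j)
  else if j = i then evalSeq ν l (fun t => a (i + t))
  else a (j + l)

theorem insertSeq_eq_update (n : ℤ) (i l : ℕ) (ν : Fam K V V) (a : ℕ → Tot V) :
    insertSeq n i l ν a = Function.update (insertSeq n i l (0 : Fam K V V) a) i
      (evalSeq ν l (fun t => a (i + t))) := by
  funext j
  by_cases h : j = i
  · subst h; simp [insertSeq]
  · simp [insertSeq, h]

/-- The triples `((k, l), i)` with `k + l = p` and `i ≤ k`: an operation of arity `l + 1` is
inserted at position `i` of one of arity `k + 1`, giving one of arity `p + 1`. -/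
def insertions (p : ℕ) : Finset ((_ : ℕ × ℕ) × ℕ) :=
  (Finset.HasAntidiagonal.antidiagonal p).sigma fun x => Finset.range (x.1 + 1)

theorem mem_insertions {p : ℕ} {x : (_ : ℕ × ℕ) × ℕ} :
    x ∈ insertions p ↔ x.1.1 + x.1.2 = p ∧ x.2 ≤ x.1.1 := by
  simp [insertions]

theorem evalSeq_diamond (n : ℤ) (μ ν : Fam K V V) (p : ℕ) (a : ℕ → Tot V) :
    evalSeq (diamond K V n μ ν) p a =
      ∑ x ∈ insertions p, evalSeq μ x.1.1 (insertSeq n x.2 x.1.2 ν a) := by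
  rw [insertions, Finset.sum_sigma, ← Finset.sum_coe_sort]
  simp only [evalSeq, diamond, sum_apply]
  refine Finset.sum_congr rfl fun x _ => ?_
  rw [← Fin.sum_univ_eq_sum_range]
  refine Finset.sum_congr rfl fun i _ => congrArg (μ x.1.1) (funext fun j => ?_)
  simp only [insertArgs, insertSeq, Fin.lt_def, Fin.ext_iff]
  split_ifs with h1 h2
  · rfl
  · refine congrArg (ν x.1.2) (funext fun t => ?_)
    rw [if_neg (show ¬ (i : ℕ) + t < i by omega), LinearMap.id_apply]
  · omega
  · rfl

theorem insertSeq_nested (m n : ℤ) (μ ν ρ : Fam K V V) {k l r i j : ℕ} (hi : i ≤ l)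
    (a : ℕ → Tot V) :
    evalSeq μ k (insertSeq m j l ν (insertSeq n (j + i) r ρ a)) =
      evalSeq μ k (Function.update (insertSeq (m + n) j (l + r) (0 : Fam K V V) a) j
        (evalSeq ν l (insertSeq n i r ρ (fun t => a (j + t))))) := by
  refine evalSeq_congr _ fun s _ => ?_
  rcases lt_trichotomy s j with h | rfl | h
  · rw [Function.update_of_ne h.ne]
    simp only [insertSeq, if_pos h, if_pos (show s < j + i by omega), koszul_koszul]
  · rw [Function.update_self]
    simp only [insertSeq, lt_irrefl, if_false, if_true]
    refine evalSeq_congr _ fun t _ => ?_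
    simp only [insertSeq, add_lt_add_iff_left, add_right_inj, add_assoc]
  · rw [Function.update_of_ne h.ne']
    simp only [insertSeq, if_neg (show ¬ s < j by omega), if_neg (show ¬ s = j by omega),
      if_neg (show ¬ s + l < j + i by omega), if_neg (show ¬ s + l = j + i by omega), add_assoc]

theorem insertSeq_comm {m n : ℤ} (μ : Fam K V V) {ν ρ : Fam K V V} (hν : ν ∈ cochain K V V m)
    {k l r j i : ℕ} (hj : j < i) (hk : j ≤ k) (a : ℕ → Tot V) :
    evalSeq μ k (insertSeq m j l ν (insertSeq n (i + l) r ρ a)) =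
      (m * n).negOnePow • evalSeq μ k (insertSeq n i r ρ (insertSeq m j l ν a)) := by
  set b := insertSeq n i r ρ (insertSeq m j l ν a) with hb
  have hbj : b = Function.update b j (koszul K V n (evalSeq ν l fun t => a (j + t))) := by
    rw [eq_comm, Function.update_eq_self_iff]
    simp [hb, insertSeq, hj]
  rw [hbj, evalSeq_update _ hk, ← LinearMap.map_smul_of_tower, ← evalSeq_koszul hν,
    ← evalSeq_update _ hk]
  refine evalSeq_congr _ fun s _ => ?_
  rcases lt_trichotomy s j with h | rfl | h
  · rw [Function.update_of_ne h.ne]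
    simp only [hb, insertSeq, if_pos h, if_pos (show s < i + l by omega),
      if_pos (show s < i by omega), koszul_koszul, add_comm m n]
  · rw [Function.update_self]
    simp only [insertSeq, lt_irrefl, if_false, if_true]
    refine evalSeq_congr _ fun t _ => ?_
    rw [if_pos (by omega)]
  · rw [Function.update_of_ne h.ne']
    simp only [hb, insertSeq, if_neg (show ¬ s < j by omega), if_neg (show ¬ s = j by omega),
      add_lt_add_iff_right, add_left_inj]
    split_ifs with h1 h2
    · rfl
    · refine evalSeq_congr _ fun t _ => ?_
      rw [if_neg (by omega), if_neg (by omega), add_right_comm]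
    · omega
    · omega
    · rw [add_right_comm]

/-- The index set of the terms of `(μ ⋄ ν) ⋄ ρ`: first the insertion of `ρ`, then that of `ν`. -/
def insertionPairs (p : ℕ) : Finset ((_ : (_ : ℕ × ℕ) × ℕ) × ((_ : ℕ × ℕ) × ℕ)) :=
  (insertions p).sigma fun x => insertions x.1.1

/-- The term of `(μ ⋄ ν) ⋄ ρ` indexed by an element of `insertionPairs`. -/
def insertionTerm (m n : ℤ) (μ ν ρ : Fam K V V) (a : ℕ → Tot V)
    (x : (_ : (_ : ℕ × ℕ) × ℕ) × ((_ : ℕ × ℕ) × ℕ)) : Tot V :=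
  evalSeq μ x.2.1.1 (insertSeq m x.2.2 x.2.1.2 ν (insertSeq n x.1.2 x.1.1.2 ρ a))

theorem evalSeq_diamond_diamond_left (m n : ℤ) (μ ν ρ : Fam K V V) (p : ℕ) (a : ℕ → Tot V) :
    evalSeq (diamond K V n (diamond K V m μ ν) ρ) p a =
      ∑ x ∈ insertionPairs p, insertionTerm m n μ ν ρ a x := by
  simp only [evalSeq_diamond, insertionPairs, insertionTerm, Finset.sum_sigma]

theorem evalSeq_diamond_diamond_right (m n : ℤ) (μ ν ρ : Fam K V V) (p : ℕ) (a : ℕ → Tot V) :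
    evalSeq (diamond K V (m + n) μ (diamond K V n ν ρ)) p a =
      ∑ x ∈ (insertions p).sigma fun x => insertions x.1.2,
        evalSeq μ x.1.1.1 (insertSeq m x.1.2 x.2.1.1 ν
          (insertSeq n (x.1.2 + x.2.2) x.2.1.2 ρ a)) := by
  rw [evalSeq_diamond, Finset.sum_sigma]
  refine Finset.sum_congr rfl fun x hx => ?_
  have hx' := (mem_insertions.1 hx).2
  rw [insertSeq_eq_update, evalSeq_diamond, evalSeq_update _ hx', map_sum]
  refine Finset.sum_congr rfl fun y hy => ?_
  obtain ⟨hy1, hy2⟩ := mem_insertions.1 hy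
  rw [← evalSeq_update _ hx', insertSeq_nested m n _ _ _ hy2, hy1]

theorem sum_nested_insertions (m n : ℤ) (μ ν ρ : Fam K V V) (p : ℕ) (a : ℕ → Tot V) :
    ∑ x ∈ insertionPairs p with x.2.2 ≤ x.1.2 ∧ x.1.2 ≤ x.2.2 + x.2.1.2,
        insertionTerm m n μ ν ρ a x =
      evalSeq (diamond K V (m + n) μ (diamond K V n ν ρ)) p a := by
  rw [evalSeq_diamond_diamond_right]
  refine Finset.sum_nbij'
    (fun x => ⟨⟨(x.2.1.1, x.2.1.2 + x.1.1.2), x.2.2⟩, ⟨(x.2.1.2, x.1.1.2), x.1.2 - x.2.2⟩⟩)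
    (fun x => ⟨⟨(x.1.1.1 + x.2.1.1, x.2.1.2), x.1.2 + x.2.2⟩, ⟨(x.1.1.1, x.2.1.1), x.1.2⟩⟩)
    ?_ ?_ ?_ ?_ ?_
  all_goals
    rintro ⟨⟨⟨k', r⟩, i⟩, ⟨⟨k, l⟩, j⟩⟩ h
    simp only [insertionPairs, insertionTerm, Finset.mem_filter, Finset.mem_sigma, mem_insertions,
      Sigma.mk.injEq, heq_eq_eq, Prod.mk.injEq, true_and, and_true] at h ⊢
  · omega
  · omega
  · omega
  · omega
  · rw [Nat.add_sub_cancel' h.2.1]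

theorem sum_right_insertions {m n : ℤ} (μ : Fam K V V) {ν : Fam K V V} (ρ : Fam K V V)
    (hν : ν ∈ cochain K V V m) (p : ℕ) (a : ℕ → Tot V) :
    ∑ x ∈ insertionPairs p with x.2.2 + x.2.1.2 < x.1.2, insertionTerm m n μ ν ρ a x =
      (m * n).negOnePow •
        ∑ x ∈ insertionPairs p with x.1.2 < x.2.2, insertionTerm n m μ ρ ν a x := by
  rw [Finset.smul_sum]
  refine Finset.sum_nbij'
    (fun x => ⟨⟨(x.2.1.1 + x.1.1.2, x.2.1.2), x.2.2⟩, ⟨(x.2.1.1, x.1.1.2), x.1.2 - x.2.1.2⟩⟩)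
    (fun x => ⟨⟨(x.2.1.1 + x.1.1.2, x.2.1.2), x.2.2 + x.1.1.2⟩, ⟨(x.2.1.1, x.1.1.2), x.1.2⟩⟩)
    ?_ ?_ ?_ ?_ ?_
  all_goals
    rintro ⟨⟨⟨k', r⟩, i⟩, ⟨⟨k, l⟩, j⟩⟩ h
    simp only [insertionPairs, insertionTerm, Finset.mem_filter, Finset.mem_sigma, mem_insertions,
      Sigma.mk.injEq, heq_eq_eq, Prod.mk.injEq, true_and, and_true] at h ⊢
  · omega
  · omega
  · omega
  · omega
  · obtain ⟨i, rfl⟩ : ∃ i', i = i' + l := ⟨i - l, by omega⟩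
    rw [insertSeq_comm μ hν (by omega) (by omega), Nat.add_sub_cancel]

theorem associator_eq {m n : ℤ} (μ : Fam K V V) {ν : Fam K V V} (ρ : Fam K V V)
    (hν : ν ∈ cochain K V V m) (p : ℕ) (a : ℕ → Tot V) :
    evalSeq (diamond K V n (diamond K V m μ ν) ρ) p a =
      evalSeq (diamond K V (m + n) μ (diamond K V n ν ρ)) p a +
        (∑ x ∈ insertionPairs p with x.1.2 < x.2.2, insertionTerm m n μ ν ρ a x +
          (m * n).negOnePow •
            ∑ x ∈ insertionPairs p with x.1.2 < x.2.2, insertionTerm n m μ ρ ν a x) := by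
  rw [evalSeq_diamond_diamond_left, ← sum_nested_insertions, ← sum_right_insertions μ ρ hν,
    ← Finset.sum_union, ← Finset.sum_union]
  · refine Finset.sum_congr (Finset.ext fun x => ?_) fun _ _ => rfl
    simp only [Finset.mem_union, Finset.mem_filter, ← and_or_left]
    exact (and_iff_left (by omega)).symm
  · simp only [Finset.disjoint_left, Finset.mem_union, Finset.mem_filter]
    omega
  · simp only [Finset.disjoint_left, Finset.mem_filter]
    omega

theorem diamond_preLie {m n : ℤ} (μ : Fam K V V) {ν ρ : Fam K V V}
    (hν : ν ∈ cochain K V V m) (hρ : ρ ∈ cochain K V V n) :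
    diamond K V n (diamond K V m μ ν) ρ - diamond K V (m + n) μ (diamond K V n ν ρ) =
      (m * n).negOnePow • (diamond K V m (diamond K V n μ ρ) ν -
        diamond K V (m + n) μ (diamond K V m ρ ν)) := by
  refine fam_ext fun p a => ?_
  have hνρ := associator_eq (n := n) μ ρ hν p a
  have hρν := associator_eq (n := m) μ ν hρ p a
  rw [add_comm n m, mul_comm n m] at hρν
  change evalSeq _ p a - evalSeq _ p a = (m * n).negOnePow • (evalSeq _ p a - evalSeq _ p a)
  rw [hνρ, hρν, add_sub_cancel_left, add_sub_cancel_left, smul_add, smul_smul,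
    Int.units_mul_self, one_smul, add_comm]

theorem diamond_diamond_self {m : ℤ} (hm : Odd m) (φ : Fam K V V) {μ : Fam K V V}
    (hμ : μ ∈ cochain K V V m) :
    diamond K V m (diamond K V m φ μ) μ = diamond K V (m + m) φ (diamond K V m μ μ) := by
  refine fam_ext fun p a => ?_
  rw [associator_eq φ μ hμ, Int.negOnePow_odd _ (hm.mul hm), Units.neg_smul, one_smul,
    add_neg_cancel, add_zero]

end PreLie

section GradedLie

variable {K : Type u} [Field K]
variable {V : ℤ → Type v} [∀ i, AddCommGroup (V i)] [∀ i, Module K (V i)]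

variable (K V) in
/-- `diamond` as a bilinear map. -/
def diamondHom (n : ℤ) : Fam K V V →ₗ[K] Fam K V V →ₗ[K] Fam K V V :=
  LinearMap.mk₂ K (diamond K V n) (diamond_add_left n) (diamond_smul_left n)
    (diamond_add_right n) (diamond_smul_right n)

theorem diamondHom_apply (n : ℤ) (φ ψ : Fam K V V) :
    diamondHom K V n φ ψ = diamond K V n φ ψ := rfl

/-- The bracket of two formal sums of maps, regarded as being of degrees `m` and `n`. -/
def famBracket (m n : ℤ) (φ ψ : Fam K V V) : Fam K V V :=
  diamondHom K V n φ ψ - (m * n).negOnePow • diamondHom K V m ψ φ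

theorem famBracket_skew (m n : ℤ) (φ ψ : Fam K V V) :
    famBracket m n φ ψ = -((m * n).negOnePow • famBracket n m ψ φ) := by
  rw [famBracket, famBracket, mul_comm n m, smul_sub, smul_smul, Int.units_mul_self, one_smul,
    neg_sub]

theorem famBracket_jacobi {l m n : ℤ} {x y z : Fam K V V} (hx : x ∈ cochain K V V l)
    (hy : y ∈ cochain K V V m) (hz : z ∈ cochain K V V n) :
    famBracket (l + m) n (famBracket l m x y) z = famBracket l (m + n) x (famBracket m n y z) +
      (m * n).negOnePow • famBracket (l + n) m (famBracket l n x z) y := by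
  have hx_assoc := diamond_preLie x hy hz
  have hy_assoc := diamond_preLie y hx hz
  have hz_assoc := diamond_preLie z hx hy
  simp only [← diamondHom_apply] at hx_assoc hy_assoc hz_assoc
  simp only [famBracket, map_sub, LinearMap.sub_apply, LinearMap.map_smul_of_tower,
    LinearMap.smul_apply, add_mul, mul_add, Int.negOnePow_add, mul_comm n m]
  generalize (l * m).negOnePow = a, (l * n).negOnePow = b, (m * n).negOnePow = c at *
  rcases Int.units_eq_one_or c with rfl | rfl <;>
    simp only [Units.smul_def, Units.val_mul, Units.val_neg, Units.val_one] at *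
  · linear_combination (norm := module) hx_assoc - (a : ℤ) • hy_assoc + (b : ℤ) • hz_assoc
  · linear_combination (norm := module) hx_assoc - (a : ℤ) • hy_assoc - (b : ℤ) • hz_assoc

theorem famBracket_famBracket_eq_zero {m n : ℤ} (hm : Odd m) {μ φ : Fam K V V}
    (hμ : μ ∈ cochain K V V m) (hφ : φ ∈ cochain K V V n) (h : diamond K V m μ μ = 0) :
    famBracket m (m + n) μ (famBracket m n μ φ) = 0 := by
  have hμ_assoc := diamond_preLie μ hμ hφ
  have hφ_assoc := diamond_diamond_self hm φ hμ
  simp only [← diamondHom_apply] at hμ_assoc hφ_assoc h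
  rw [h, map_zero] at hφ_assoc
  rw [h, map_zero, LinearMap.zero_apply, zero_sub] at hμ_assoc
  simp only [famBracket, map_sub, LinearMap.sub_apply, LinearMap.map_smul_of_tower,
    LinearMap.smul_apply, mul_add, Int.negOnePow_add, Int.negOnePow_odd _ (hm.mul hm), smul_sub,
    smul_smul, neg_mul, one_mul, Units.neg_smul, Int.units_mul_self, one_smul, hφ_assoc]
  simp only [Units.smul_def] at hμ_assoc ⊢
  linear_combination (norm := module) -hμ_assoc

variable (K V) in
/-- The graded vector space `⨁ n, C^n(V, V)`, as the total space of the family of the `C^n(V, V)`.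
It is `Cochains K V V` with the instances which `homog` and `Fam` expect. -/
abbrev CochainTot : Type v := Tot fun r : ℤ => cochain K V V r

variable (K V) in
/-- The bracket on `CochainTot K V`. -/
def totBracket : CochainTot K V →ₗ[K] CochainTot K V →ₗ[K] CochainTot K V := bracket K V

variable (K V) in
/-- The sum of the homogeneous components, as a formal sum of maps. -/
def toFam : CochainTot K V →ₗ[K] Fam K V V :=
  DirectSum.toModule K ℤ (Fam K V V) fun n => (cochain K V V n).subtype

variable (K V) in
/-- The grading of `CochainTot K V`. -/
abbrev cochainGrading (n : ℤ) : Submodule K (CochainTot K V) :=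
  homog K (fun r => cochain K V V r) n

theorem toFam_lof (n : ℤ) (φ : cochain K V V n) :
    toFam K V (DirectSum.lof K ℤ (fun r => cochain K V V r) n φ) = φ := by
  rw [toFam, DirectSum.toModule_lof, Submodule.subtype_apply]

theorem toFam_mem {n : ℤ} {x : CochainTot K V} (hx : x ∈ cochainGrading K V n) :
    toFam K V x ∈ cochain K V V n := by
  obtain ⟨φ, rfl⟩ := hx
  rw [toFam_lof]
  exact φ.2

theorem toFam_injOn (n : ℤ) : Set.InjOn (toFam K V) (cochainGrading K V n) := by
  rintro _ ⟨φ, rfl⟩ _ ⟨ψ, rfl⟩ h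
  rw [toFam_lof, toFam_lof] at h
  rw [Subtype.ext h]

theorem totBracket_mem {m n : ℤ} {x y : CochainTot K V} (hx : x ∈ cochainGrading K V m)
    (hy : y ∈ cochainGrading K V n) : totBracket K V x y ∈ cochainGrading K V (m + n) := by
  obtain ⟨φ, rfl⟩ := hx
  obtain ⟨ψ, rfl⟩ := hy
  exact ⟨_, (bracket_lof K V m n φ ψ).symm⟩

theorem toFam_totBracket {m n : ℤ} {x y : CochainTot K V} (hx : x ∈ cochainGrading K V m)
    (hy : y ∈ cochainGrading K V n) :
    toFam K V (totBracket K V x y) = famBracket m n (toFam K V x) (toFam K V y) := by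
  obtain ⟨φ, rfl⟩ := hx
  obtain ⟨ψ, rfl⟩ := hy
  rw [toFam_lof, toFam_lof]
  exact (congrArg (toFam K V) (bracket_lof K V m n φ ψ)).trans (toFam_lof _ _)

theorem totBracket_skew {m n : ℤ} {x y : CochainTot K V} (hx : x ∈ cochainGrading K V m)
    (hy : y ∈ cochainGrading K V n) :
    totBracket K V x y = -((m * n).negOnePow • totBracket K V y x) := by
  have hyx := totBracket_mem hy hx
  rw [add_comm] at hyx
  refine toFam_injOn _ (totBracket_mem hx hy) (neg_mem (Submodule.smul_of_tower_mem _ _ hyx)) ?_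
  rw [map_neg, LinearMap.map_smul_of_tower, toFam_totBracket hx hy, toFam_totBracket hy hx]
  exact famBracket_skew m n _ _

theorem totBracket_jacobi {l m n : ℤ} {x y z : CochainTot K V} (hx : x ∈ cochainGrading K V l)
    (hy : y ∈ cochainGrading K V m) (hz : z ∈ cochainGrading K V n) :
    totBracket K V (totBracket K V x y) z = totBracket K V x (totBracket K V y z) +
      (m * n).negOnePow • totBracket K V (totBracket K V x z) y := by
  have hyz := totBracket_mem hy hz
  have hxy := totBracket_mem hx hy
  have hxz := totBracket_mem hx hz
  have hx_yz := totBracket_mem hx hyz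
  have hxz_y := totBracket_mem hxz hy
  rw [← add_assoc] at hx_yz
  rw [add_right_comm] at hxz_y
  refine toFam_injOn _ (totBracket_mem hxy hz)
    (add_mem hx_yz (Submodule.smul_of_tower_mem _ _ hxz_y)) ?_
  rw [map_add, LinearMap.map_smul_of_tower, toFam_totBracket hxy hz, toFam_totBracket hx hyz,
    toFam_totBracket hxz hy, toFam_totBracket hx hy, toFam_totBracket hy hz, toFam_totBracket hx hz]
  exact famBracket_jacobi (toFam_mem hx) (toFam_mem hy) (toFam_mem hz)

end GradedLie

section Unshuffles

/-- The sign of the rearrangement of homogeneous `x_0, …, x_{n-1}`, with `x_s` of degree `d s`,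
which moves those with index in `S` to the front and keeps the order within `S` and `Sᶜ`. -/
def unshuffleSign {n : ℕ} (S : Finset (Fin n)) (d : Fin n → ℤ) : ℤˣ :=
  ∏ c ∈ S, ∏ a ∈ Sᶜ with a < c, (d a * d c).negOnePow

theorem unshuffleSign_compl {n : ℕ} (S : Finset (Fin n)) (d : Fin n → ℤ) :
    unshuffleSign Sᶜ d =
      unshuffleSign S d * ((∑ c ∈ S, d c) * ∑ c ∈ Sᶜ, d c).negOnePow := by
  have hswap : unshuffleSign Sᶜ d = ∏ c ∈ S, ∏ a ∈ Sᶜ with ¬ a < c, (d a * d c).negOnePow := by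
    simp only [unshuffleSign, compl_compl, Finset.prod_filter]
    rw [Finset.prod_comm]
    refine Finset.prod_congr rfl fun c hc => Finset.prod_congr rfl fun a ha => ?_
    have hne : c ≠ a := fun h => Finset.mem_compl.1 ha (h ▸ hc)
    simp only [not_lt, hne.le_iff_lt, mul_comm]
  have hprod : ((∑ c ∈ S, d c) * ∑ c ∈ Sᶜ, d c).negOnePow =
      unshuffleSign S d * unshuffleSign Sᶜ d := by
    rw [hswap, unshuffleSign, ← Finset.prod_mul_distrib, Finset.sum_mul_sum, negOnePow_sum]
    refine Finset.prod_congr rfl fun c _ => ?_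
    rw [Finset.prod_filter_mul_prod_filter_not, negOnePow_sum]
    exact Finset.prod_congr rfl fun a _ => by rw [mul_comm]
  rw [hprod, ← mul_assoc, Int.units_mul_self, one_mul]

variable {n : ℕ}

theorem zero_notMem_map_succ (S : Finset (Fin n)) : 0 ∉ S.map (Fin.succEmb n) := by
  simp [Fin.succ_ne_zero]

theorem compl_map_succ (S : Finset (Fin n)) :
    (S.map (Fin.succEmb n))ᶜ = insert 0 (Sᶜ.map (Fin.succEmb n)) := by
  ext a
  cases a using Fin.cases <;> simp [Fin.succ_ne_zero]

theorem compl_insert_zero_map_succ (S : Finset (Fin n)) :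
    (insert 0 (S.map (Fin.succEmb n)))ᶜ = Sᶜ.map (Fin.succEmb n) := by
  rw [← compl_compl S, ← compl_map_succ, compl_compl, compl_compl]

theorem sort_map_succ (S : Finset (Fin n)) :
    (S.map (Fin.succEmb n)).sort = S.sort.map Fin.succ :=
  (Finset.map_sort _ _ _ _ fun _ _ _ _ => Fin.succ_le_succ_iff.symm).symm

theorem sort_insert_zero_map_succ (S : Finset (Fin n)) :
    (insert 0 (S.map (Fin.succEmb n))).sort = 0 :: S.sort.map Fin.succ := by
  rw [Finset.sort_insert _ (fun b _ => Fin.zero_le b) (zero_notMem_map_succ S), sort_map_succ]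

theorem sum_finset_fin_succ {M : Type*} [AddCommMonoid M] (F : Finset (Fin (n + 1)) → M) :
    ∑ T, F T = ∑ S : Finset (Fin n),
      (F (S.map (Fin.succEmb n)) + F (insert 0 (S.map (Fin.succEmb n)))) := by
  have hpow : (Finset.univ.map (Fin.succEmb n)).powerset =
      Finset.univ.map (Finset.mapEmbedding (Fin.succEmb n)).toEmbedding := by
    ext T
    simp [Finset.subset_map_iff, eq_comm]
  have huniv : (Finset.univ : Finset (Fin (n + 1))) =
      insert 0 (Finset.univ.map (Fin.succEmb n)) := by
    simpa using compl_map_succ (∅ : Finset (Fin n))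
  rw [← Finset.powerset_univ, huniv, Finset.sum_powerset_insert (zero_notMem_map_succ _),
    ← Finset.sum_add_distrib, hpow, Finset.sum_map]
  rfl

theorem sum_finset_fin_succ_compl {M : Type*} [AddCommMonoid M] (F : Finset (Fin (n + 1)) → M) :
    ∑ T, F T = ∑ S : Finset (Fin n),
      (F (S.map (Fin.succEmb n)) + F (S.map (Fin.succEmb n))ᶜ) := by
  have hcompl := Equiv.sum_comp (compl_involutive (α := Finset (Fin n))).toPerm
    fun S : Finset (Fin n) => F (insert 0 (S.map (Fin.succEmb n)))
  simp only [sum_finset_fin_succ, Finset.sum_add_distrib, compl_map_succ, ← hcompl,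
    Function.Involutive.coe_toPerm]

theorem unshuffleSign_insert_zero_map_succ (S : Finset (Fin n)) (d : Fin (n + 1) → ℤ) :
    unshuffleSign (insert 0 (S.map (Fin.succEmb n))) d = unshuffleSign S fun i => d i.succ := by
  rw [unshuffleSign, compl_insert_zero_map_succ, Finset.prod_insert (zero_notMem_map_succ S)]
  simp only [Finset.prod_map, Finset.filter_map, Fin.not_lt_zero, Function.comp_def,
    Finset.filter_false, Finset.prod_empty, one_mul, Fin.coe_succEmb, Fin.succ_lt_succ_iff,
    unshuffleSign]

theorem unshuffleSign_map_succ (S : Finset (Fin n)) (d : Fin (n + 1) → ℤ) :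
    unshuffleSign (S.map (Fin.succEmb n)) d =
      unshuffleSign S (fun i => d i.succ) * (d 0 * ∑ i ∈ S, d i.succ).negOnePow := by
  rw [← compl_compl (S.map _), unshuffleSign_compl, compl_map_succ,
    unshuffleSign_insert_zero_map_succ, compl_insert_zero_map_succ, unshuffleSign_compl,
    compl_compl, Finset.sum_insert (zero_notMem_map_succ _)]
  simp only [Finset.sum_map, Fin.coe_succEmb, add_mul, Int.negOnePow_add]
  rw [mul_comm (∑ i ∈ Sᶜ, _), mul_mul_mul_comm, Int.units_mul_self, mul_one]

end Unshuffles

section Koszul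

theorem koszulSign_eq_prod_values {n : ℕ} (σ : Equiv.Perm (Fin n)) (d : Fin n → ℤ) :
    koszulSign σ d = ∏ q : Fin n × Fin n with q.1 < q.2 ∧ σ⁻¹ q.2 < σ⁻¹ q.1,
      (d q.1 * d q.2).negOnePow := by
  rw [koszulSign]
  refine Finset.prod_equiv ((Equiv.prodComm _ _).trans (Equiv.prodCongr σ σ)) (fun q => ?_)
    fun q _ => ?_
  · simp [and_comm]
  · simp [mul_comm]

theorem koszulSign_one {n : ℕ} (d : Fin n → ℤ) : koszulSign 1 d = 1 :=
  Finset.prod_eq_one fun _ hq => absurd (Finset.mem_filter.1 hq).2.1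
    (Finset.mem_filter.1 hq).2.2.not_gt

theorem swap_castSucc_succ_lt_iff {n : ℕ} (i : Fin n) (a c : Fin (n + 1)) :
    Equiv.swap i.castSucc i.succ c < Equiv.swap i.castSucc i.succ a ↔
      a = i.castSucc ∧ c = i.succ ∨ c < a ∧ ¬ (c = i.castSucc ∧ a = i.succ) := by
  simp only [Equiv.swap_apply_def, Fin.ext_iff, Fin.lt_def]
  split_ifs <;> simp only [Fin.val_castSucc, Fin.val_succ] at * <;> omega

theorem koszulSign_mul_swap_of_lt {n : ℕ} {σ : Equiv.Perm (Fin (n + 1))} {i : Fin n}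
    (hσ : σ i.castSucc < σ i.succ) (d : Fin (n + 1) → ℤ) :
    koszulSign (σ * Equiv.swap i.castSucc i.succ) d =
      koszulSign σ d * (d (σ i.castSucc) * d (σ i.succ)).negOnePow := by
  rw [koszulSign_eq_prod_values, koszulSign_eq_prod_values, mul_comm,
    ← Finset.prod_insert (a := (σ i.castSucc, σ i.succ)) (f := fun q => (d q.1 * d q.2).negOnePow)
      (by simp [Fin.castSucc_lt_succ.not_gt])]
  refine Finset.prod_congr (Finset.ext ?_) fun _ _ => rfl
  rintro ⟨a, c⟩
  obtain ⟨a, rfl⟩ := σ.surjective a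
  obtain ⟨c, rfl⟩ := σ.surjective c
  have hinv (e : Fin (n + 1)) : (σ * Equiv.swap i.castSucc i.succ)⁻¹ (σ e) =
      Equiv.swap i.castSucc i.succ e := by simp
  have hinv_self (e : Fin (n + 1)) : σ⁻¹ (σ e) = e := σ.symm_apply_apply e
  simp only [Finset.mem_filter, Finset.mem_univ, true_and, Finset.mem_insert, Prod.mk.injEq,
    σ.injective.eq_iff, hinv, hinv_self, swap_castSucc_succ_lt_iff]
  constructor
  · tauto
  · rintro (⟨rfl, rfl⟩ | ⟨hac, hca⟩)
    · exact ⟨hσ, Or.inl ⟨rfl, rfl⟩⟩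
    · refine ⟨hac, Or.inr ⟨hca, ?_⟩⟩
      rintro ⟨rfl, rfl⟩
      exact hac.not_gt hσ

theorem koszulSign_mul_swap {n : ℕ} (σ : Equiv.Perm (Fin (n + 1))) (i : Fin n)
    (d : Fin (n + 1) → ℤ) :
    koszulSign (σ * Equiv.swap i.castSucc i.succ) d =
      koszulSign σ d * (d (σ i.castSucc) * d (σ i.succ)).negOnePow := by
  rcases lt_or_gt_of_ne (σ.injective.ne (Fin.castSucc_lt_succ (i := i)).ne) with h | h
  · exact koszulSign_mul_swap_of_lt h d
  · have := koszulSign_mul_swap_of_lt (σ := σ * Equiv.swap i.castSucc i.succ) (i := i)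
      (by simpa using h) d
    simp only [mul_assoc, Equiv.swap_mul_self, mul_one, Equiv.Perm.mul_apply,
      Equiv.swap_apply_left, Equiv.swap_apply_right, mul_comm (d (σ i.succ))] at this
    rw [this, mul_assoc, Int.units_mul_self, mul_one]

end Koszul

section Shuffles

variable {n : ℕ}

/-- The set of values of `σ` on the first `i` positions. -/
def firstBlock (i : ℕ) (σ : Equiv.Perm (Fin n)) : Finset (Fin n) := {c | (σ⁻¹ c).val < i}

theorem apply_mem_firstBlock {i : ℕ} {σ : Equiv.Perm (Fin n)} {t : Fin n} :
    σ t ∈ firstBlock i σ ↔ t.val < i := by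
  simp [firstBlock]

theorem card_firstBlock {i : ℕ} (hi : i ≤ n) (σ : Equiv.Perm (Fin n)) :
    (firstBlock i σ).card = i := by
  have hmap : firstBlock i σ = ({t | t.val < i} : Finset (Fin n)).map σ.toEmbedding := by
    ext c
    simp [firstBlock, Finset.mem_map_equiv]
  rw [hmap, Finset.card_map, Fin.card_filter_val_lt, min_eq_right hi]

theorem isShuffle_iff_eq_sort {i : ℕ} {σ : Equiv.Perm (Fin n)} :
    IsShuffle i σ ↔ σ = Tuple.sort fun c => decide (c ∉ firstBlock i σ) := by
  rw [Tuple.eq_sort_iff]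
  simp only [apply_mem_firstBlock, decide_eq_decide, not_lt]
  refine ⟨fun hσ => ⟨fun s t hst => ?_, fun s t hst h => hσ s t hst ?_⟩,
    fun ⟨_, hσ⟩ s t hst h => hσ s t hst ?_⟩
  · rw [Bool.le_iff_imp]
    simpa [apply_mem_firstBlock] using fun hs : i ≤ s.val => hs.trans hst
  · rw [← not_lt, or_iff_not_imp_left]
    exact fun ht hs => by omega
  · rw [Fin.lt_def] at hst
    omega

theorem firstBlock_sort (S : Finset (Fin n)) :
    firstBlock S.card (Tuple.sort fun c => decide (c ∉ S)) = S := by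
  ext c
  set σ := Tuple.sort fun c => decide (c ∉ S)
  obtain ⟨t, rfl⟩ := σ.surjective c
  have hcard : Finset.card {t | decide (σ t ∉ S) ≤ false} = S.card :=
    Finset.card_equiv σ fun t => by simp [Bool.le_iff_imp]
  rw [apply_mem_firstBlock, ← hcard]
  refine (Tuple.lt_card_le_iff_apply_le_of_monotone
    (Tuple.monotone_sort fun c => decide (c ∉ S))).trans ?_
  simp [Bool.le_iff_imp, σ]

theorem sum_isShuffle {M : Type*} [AddCommMonoid M] {i : ℕ} (hi : i ≤ n)
    (F : Finset (Fin n) → M) [DecidablePred (IsShuffle i (n := n))] :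
    ∑ σ : Equiv.Perm (Fin n) with IsShuffle i σ, F (firstBlock i σ) =
      ∑ S ∈ Finset.univ.powersetCard i, F S := by
  refine Finset.sum_nbij' (firstBlock i) (fun S => Tuple.sort fun c => decide (c ∉ S))
    (fun σ _ => Finset.mem_powersetCard_univ.2 (card_firstBlock hi σ)) (fun S hS => ?_)
    (fun σ hσ => (isShuffle_iff_eq_sort.1 (Finset.mem_filter.1 hσ).2).symm) (fun S hS => ?_)
    fun _ _ => rfl
  all_goals obtain rfl := Finset.mem_powersetCard_univ.1 hS
  · rw [Finset.mem_filter_univ, isShuffle_iff_eq_sort, firstBlock_sort]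
  · exact firstBlock_sort S

theorem sum_antidiagonal_isShuffle {M : Type*} [AddCommMonoid M] (p : ℕ)
    [∀ i, DecidablePred (IsShuffle i (n := p + 1))] (F : Finset (Fin (p + 1)) → M) (hF : F ∅ = 0) :
    ∑ y ∈ Finset.HasAntidiagonal.antidiagonal p,
      ∑ σ : Equiv.Perm (Fin (p + 1)) with IsShuffle (y.2 + 1) σ, F (firstBlock (y.2 + 1) σ) =
      ∑ S, F S := by
  rw [← Finset.powerset_univ, Finset.sum_powerset, Finset.card_univ, Fintype.card_fin,
    Finset.sum_range_succ', Finset.powersetCard_zero, Finset.sum_singleton, hF, add_zero,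
    ← Finset.Nat.sum_antidiagonal_swap,
    Finset.Nat.sum_antidiagonal_eq_sum_range_succ_mk]
  exact Finset.sum_congr rfl fun i hi => sum_isShuffle (Finset.mem_range.1 hi) F

theorem ofFn_eq_sort {k : ℕ} {S : Finset (Fin n)} {e : Fin k → Fin n} (he : StrictMono e)
    (hS : ∀ c, c ∈ S ↔ ∃ t, e t = c) : List.ofFn e = S.sort := by
  have hS' : S = (List.ofFn e).toFinset := Finset.ext fun c => by
    rw [List.mem_toFinset, List.mem_ofFn, hS]
  rw [hS']
  exact ((List.toFinset_sort _ (List.nodup_ofFn.2 he.injective)).2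
    (List.pairwise_ofFn.2 fun _ _ h => (he h).le)).symm

namespace IsShuffle

variable {i j : ℕ} {σ : Equiv.Perm (Fin n)}

theorem ofFn_first (hσ : IsShuffle i σ) (h : i ≤ n) :
    List.ofFn (fun t : Fin i => σ ⟨t, by omega⟩) = (firstBlock i σ).sort := by
  refine ofFn_eq_sort (fun s t hst => hσ _ _ hst (Or.inl t.2)) fun c => ?_
  obtain ⟨t, rfl⟩ := σ.surjective c
  simp only [apply_mem_firstBlock, σ.injective.eq_iff]
  exact ⟨fun ht => ⟨⟨t, ht⟩, rfl⟩, fun ⟨s, hs⟩ => hs ▸ s.2⟩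

theorem ofFn_second (hσ : IsShuffle i σ) (h : i + j = n) :
    List.ofFn (fun t : Fin j => σ ⟨i + t, by omega⟩) = (firstBlock i σ)ᶜ.sort := by
  refine ofFn_eq_sort (fun s t hst => hσ _ _ (Nat.add_lt_add_left hst i)
    (Or.inr (Nat.le_add_right _ _))) fun c => ?_
  obtain ⟨t, rfl⟩ := σ.surjective c
  simp only [Finset.mem_compl, apply_mem_firstBlock, σ.injective.eq_iff, not_lt]
  exact ⟨fun ht => ⟨⟨t - i, by omega⟩, Fin.ext (Nat.add_sub_cancel' ht)⟩,
    fun ⟨s, hs⟩ => hs ▸ Nat.le_add_right _ _⟩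

theorem koszulSign_eq (hσ : IsShuffle i σ) (d : Fin n → ℤ) :
    koszulSign σ d = unshuffleSign (firstBlock i σ) d := by
  rw [koszulSign_eq_prod_values, unshuffleSign]
  refine Finset.prod_finset_product_right _ _ _ fun ⟨a, c⟩ => ?_
  obtain ⟨a, rfl⟩ := σ.surjective a
  obtain ⟨c, rfl⟩ := σ.surjective c
  simp only [Finset.mem_filter, Finset.mem_univ, true_and, Finset.mem_compl, apply_mem_firstBlock,
    Equiv.Perm.inv_def, Equiv.symm_apply_apply]
  refine ⟨fun ⟨hac, hca⟩ => ?_, fun ⟨_, _, hac⟩ => ⟨hac, ?_⟩⟩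
  · have : ¬ (a.val < i ∨ i ≤ c.val) := fun h => (hσ c a hca h).not_gt hac
    omega
  · rw [Fin.lt_def]
    omega

end IsShuffle

end Shuffles

section VData

/-- A graded Lie algebra: a bilinear bracket `B` on `L`, additive in the degrees of a grading `gr`,
graded skew-symmetric, and with the graded Jacobi identity in the form of a derivation rule. -/
structure IsGradedLie {R : Type u} {L : Type v} [CommRing R] [AddCommGroup L] [Module R L]
    (B : L →ₗ[R] L →ₗ[R] L) (gr : ℤ → Submodule R L) : Prop where
  bracket_mem {m n : ℤ} {x y : L} : x ∈ gr m → y ∈ gr n → B x y ∈ gr (m + n)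
  skew {m n : ℤ} {x y : L} : x ∈ gr m → y ∈ gr n → B x y = -((m * n).negOnePow • B y x)
  jacobi {l m n : ℤ} {x y z : L} : x ∈ gr l → y ∈ gr m → z ∈ gr n →
    B (B x y) z = B x (B y z) + (m * n).negOnePow • B (B x z) y

/-- Voronov's V-data: an abelian subalgebra `H`, embedded by `ι` into a graded Lie algebra `L`, a
projection `P` of `L` onto `H` whose kernel is a subalgebra, and an element `π` of degree `-1` in
this kernel. That `π` squares to zero is expressed by `[π, [π, y]] = 0`, which `[π, π] = 0` implies
only if `2` is not a zero divisor. -/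
structure IsVData {R : Type u} {L : Type v} {H : Type w} [CommRing R] [AddCommGroup L] [Module R L]
    [AddCommGroup H] [Module R H] (B : L →ₗ[R] L →ₗ[R] L) (gr : ℤ → Submodule R L)
    (hr : ℤ → Submodule R H) (ι : H →ₗ[R] L) (P : L →ₗ[R] H) (π : L) : Prop
    extends IsGradedLie B gr where
  incl_mem {n : ℤ} {f : H} : f ∈ hr n → ι f ∈ gr n
  proj_mem {n : ℤ} {x : L} : x ∈ gr n → P x ∈ hr n
  proj_incl (f : H) : P (ι f) = f
  bracket_incl_incl {m n : ℤ} {f g : H} : f ∈ hr m → g ∈ hr n → B (ι f) (ι g) = 0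
  proj_bracket_of_ker {m n : ℤ} {x y : L} : x ∈ gr m → y ∈ gr n → P x = 0 → P y = 0 →
    P (B x y) = 0
  pi_mem : π ∈ gr (-1)
  proj_pi : P π = 0
  bracket_pi_bracket_pi {n : ℤ} {y : L} : y ∈ gr n → B π (B π y) = 0

variable {R : Type u} {L : Type v} {H : Type w} [CommRing R] [AddCommGroup L] [Module R L]
variable [AddCommGroup H] [Module R H]

/-- The iterated bracket `x ↦ [⋯[[x, f₁], f₂], ⋯, f_k]`. -/
def nest (B : L →ₗ[R] L →ₗ[R] L) (ι : H →ₗ[R] L) : List H → L →ₗ[R] L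
  | [] => LinearMap.id
  | f :: l => nest B ι l ∘ₗ B.flip (ι f)

variable {B : L →ₗ[R] L →ₗ[R] L} {gr : ℤ → Submodule R L} {hr : ℤ → Submodule R H} {ι : H →ₗ[R] L}
variable {P : L →ₗ[R] H} {π : L}

theorem nest_nil (x : L) : nest B ι [] x = x := rfl

theorem nest_cons (f : H) (l : List H) (x : L) : nest B ι (f :: l) x = nest B ι l (B x (ι f)) := rfl

theorem nest_concat (l : List H) (f : H) (x : L) :
    nest B ι (l ++ [f]) x = B (nest B ι l x) (ι f) := by
  induction l generalizing x with
  | nil => rfl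
  | cons _ _ ih => exact ih _

theorem sum_map_sort {n : ℕ} (S : Finset (Fin n)) (d : Fin n → ℤ) :
    (S.sort.map d).sum = ∑ c ∈ S, d c := by
  rw [Finset.sum, ← Finset.sort_eq S (· ≤ ·), Multiset.map_coe, Multiset.sum_coe]

namespace IsVData

variable (hV : IsVData B gr hr ι P π)
include hV

theorem nest_mem {α : Type*} {f : α → H} {d : α → ℤ} (hf : ∀ s, f s ∈ hr (d s)) (l : List α)
    {m : ℤ} {x : L} (hx : x ∈ gr m) : nest B ι (l.map f) x ∈ gr (m + (l.map d).sum) := by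
  induction l generalizing m x with
  | nil => simpa [nest_nil] using hx
  | cons a l ih =>
    simpa only [List.map_cons, List.sum_cons, add_assoc, nest_cons] using
      ih (hV.bracket_mem hx (hV.incl_mem (hf a)))

theorem bracket_incl_comm {l m n : ℤ} {x : L} {f g : H} (hx : x ∈ gr l) (hf : f ∈ hr m)
    (hg : g ∈ hr n) :
    B (B x (ι f)) (ι g) = (m * n).negOnePow • B (B x (ι g)) (ι f) := by
  rw [hV.jacobi hx (hV.incl_mem hf) (hV.incl_mem hg), hV.bracket_incl_incl hf hg, map_zero,
    zero_add]

theorem nest_bracket_incl {α : Type*} {f : α → H} {d : α → ℤ} (hf : ∀ s, f s ∈ hr (d s))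
    (l : List α) {m n : ℤ} {x : L} {g : H} (hx : x ∈ gr m) (hg : g ∈ hr n) :
    nest B ι (l.map f) (B x (ι g)) =
      (n * (l.map d).sum).negOnePow • B (nest B ι (l.map f) x) (ι g) := by
  induction l generalizing m x with
  | nil => simp [nest_nil]
  | cons a l ih =>
    rw [List.map_cons, nest_cons, hV.bracket_incl_comm hx hg (hf a), LinearMap.map_smul_of_tower,
      ih (hV.bracket_mem hx (hV.incl_mem (hf a))), smul_smul, ← Int.negOnePow_add, ← mul_add,
      nest_cons, List.map_cons, List.sum_cons]

theorem nest_bracket {k : ℕ} {f : Fin k → H} {d : Fin k → ℤ} (hf : ∀ s, f s ∈ hr (d s)) {m n : ℤ}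
    {x y : L} (hx : x ∈ gr m) (hy : y ∈ gr n) :
    nest B ι (List.ofFn f) (B x y) = ∑ S : Finset (Fin k),
      (unshuffleSign S d * (n * ∑ c ∈ S, d c).negOnePow) •
        B (nest B ι (S.sort.map f) x) (nest B ι (Sᶜ.sort.map f) y) := by
  induction k generalizing m n x y with
  | zero =>
    rw [Fintype.sum_subsingleton _ ∅]
    simp [nest_nil, unshuffleSign]
  | succ k ih =>
    have hf₀ := hV.incl_mem (hf 0)
    rw [List.ofFn_succ, nest_cons, hV.jacobi hx hy hf₀, map_add, LinearMap.map_smul_of_tower,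
      ih (fun s => hf s.succ) hx (hV.bracket_mem hy hf₀),
      ih (fun s => hf s.succ) (hV.bracket_mem hx hf₀) hy, sum_finset_fin_succ, Finset.smul_sum,
      ← Finset.sum_add_distrib]
    refine Finset.sum_congr rfl fun S _ => ?_
    rw [compl_map_succ, compl_insert_zero_map_succ, sort_insert_zero_map_succ,
      sort_insert_zero_map_succ, sort_map_succ, sort_map_succ, unshuffleSign_map_succ,
      unshuffleSign_insert_zero_map_succ, Finset.sum_insert (zero_notMem_map_succ S)]
    simp only [Finset.sum_map, Fin.coe_succEmb, List.map_cons, List.map_map, Function.comp_def,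
      nest_cons, add_mul, mul_add, Int.negOnePow_add, smul_smul, mul_left_comm,
      mul_comm]

theorem nest_ofFn_swap {k : ℕ} (i : Fin k) {f : Fin (k + 1) → H} {d : Fin (k + 1) → ℤ}
    (hf : ∀ s, f s ∈ hr (d s)) {m : ℤ} {x : L} (hx : x ∈ gr m) :
    nest B ι (List.ofFn fun s => f (Equiv.swap i.castSucc i.succ s)) x =
      (d i.castSucc * d i.succ).negOnePow • nest B ι (List.ofFn f) x := by
  induction k generalizing m x with
  | zero => exact i.elim0
  | succ k ih =>
    cases i using Fin.cases with
    | zero =>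
      have hne (s : Fin k) : s.succ.succ ≠ Fin.succ 0 :=
        (Fin.succ_injective _).ne (Fin.succ_ne_zero s)
      simp only [List.ofFn_succ, nest_cons, Fin.castSucc_zero, Equiv.swap_apply_left,
        Equiv.swap_apply_right, Equiv.swap_apply_of_ne_of_ne (Fin.succ_ne_zero _) (hne _)]
      rw [hV.bracket_incl_comm hx (hf _) (hf 0), LinearMap.map_smul_of_tower, mul_comm]
    | succ i =>
      have hswap (s : Fin (k + 1)) : Equiv.swap i.succ.castSucc i.succ.succ s.succ =
          (Equiv.swap i.castSucc i.succ s).succ := by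
        rw [Fin.castSucc_succ, (Fin.succ_injective _).swap_apply]
      have hzero : Equiv.swap i.succ.castSucc i.succ.succ 0 = 0 :=
        Equiv.swap_apply_of_ne_of_ne (Fin.succ_ne_zero i.castSucc).symm (Fin.succ_ne_zero _).symm
      rw [List.ofFn_succ, List.ofFn_succ (f := f), nest_cons, nest_cons, hzero]
      simp only [hswap]
      exact ih i (fun s => hf s.succ) (hV.bracket_mem hx (hV.incl_mem (hf 0)))

theorem nest_ofFn_perm {k : ℕ} (σ : Equiv.Perm (Fin k)) {f : Fin k → H} {d : Fin k → ℤ}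
    (hf : ∀ s, f s ∈ hr (d s)) {m : ℤ} {x : L} (hx : x ∈ gr m) :
    nest B ι (List.ofFn fun s => f (σ s)) x = koszulSign σ d • nest B ι (List.ofFn f) x := by
  cases k with
  | zero => rw [Subsingleton.elim σ 1, koszulSign_one, one_smul]; rfl
  | succ k =>
    have hσ : σ ∈ Submonoid.closure (Set.range fun i : Fin k => Equiv.swap i.castSucc i.succ) :=
      Equiv.Perm.mclosure_swap_castSucc_succ k ▸ Submonoid.mem_top σ
    induction hσ using Submonoid.closure_induction_right with
    | one => rw [koszulSign_one, one_smul]; rfl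
    | mul_right σ _ τ hτ ih =>
      obtain ⟨i, rfl⟩ := hτ
      rw [koszulSign_mul_swap, mul_comm, mul_smul, ← ih]
      exact hV.nest_ofFn_swap i (fun s => hf (σ s)) hx

theorem proj_bracket {m n : ℤ} {x y : L} (hx : x ∈ gr m) (hy : y ∈ gr n) :
    P (B x y) = P (B (ι (P x)) y) + P (B x (ι (P y))) := by
  have hxP := hV.incl_mem (hV.proj_mem hx)
  have hyP := hV.incl_mem (hV.proj_mem hy)
  have hker := hV.proj_bracket_of_ker (sub_mem hx hxP) (sub_mem hy hyP)
    (by rw [map_sub, hV.proj_incl, sub_self]) (by rw [map_sub, hV.proj_incl, sub_self])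
  simp only [map_sub, LinearMap.sub_apply,
    hV.bracket_incl_incl (hV.proj_mem hx) (hV.proj_mem hy), sub_zero] at hker
  linear_combination (norm := module) hker

end IsVData

/-- The summand of the `L_∞` relation in which the arguments with index in `S` go to the inner
derived bracket, without its Koszul sign. -/
def jacobiTerm (B : L →ₗ[R] L →ₗ[R] L) (ι : H →ₗ[R] L) (P : L →ₗ[R] H) (π : L) {k : ℕ}
    (f : Fin k → H) (S : Finset (Fin k)) : H :=
  P (nest B ι (P (nest B ι (S.sort.map f) π) :: Sᶜ.sort.map f) π)

namespace IsVData

variable (hV : IsVData B gr hr ι P π)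
include hV

theorem jacobiTerm_empty {k : ℕ} (f : Fin k → H) : jacobiTerm B ι P π f ∅ = 0 := by
  simp [jacobiTerm, nest, hV.proj_pi]

theorem nest_pi_mem {k : ℕ} {f : Fin k → H} {d : Fin k → ℤ} (hf : ∀ s, f s ∈ hr (d s))
    (S : Finset (Fin k)) : nest B ι (S.sort.map f) π ∈ gr (-1 + ∑ c ∈ S, d c) := by
  rw [← sum_map_sort]
  exact hV.nest_mem hf _ hV.pi_mem

theorem jacobiTerm_eq {k : ℕ} {f : Fin k → H} {d : Fin k → ℤ} (hf : ∀ s, f s ∈ hr (d s))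
    (S : Finset (Fin k)) :
    jacobiTerm B ι P π f S = ((-1 + ∑ c ∈ S, d c) * ∑ c ∈ Sᶜ, d c).negOnePow •
      P (B (nest B ι (Sᶜ.sort.map f) π) (ι (P (nest B ι (S.sort.map f) π)))) := by
  rw [jacobiTerm, nest_cons,
    hV.nest_bracket_incl hf _ hV.pi_mem (hV.proj_mem (hV.nest_pi_mem hf S)), sum_map_sort,
    LinearMap.map_smul_of_tower]

theorem proj_bracket_nest_nest {k : ℕ} {f : Fin k → H} {d : Fin k → ℤ} (hf : ∀ s, f s ∈ hr (d s))
    (S : Finset (Fin k)) :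
    (unshuffleSign S d * (∑ c ∈ S, d c).negOnePow) •
      P (B (nest B ι (S.sort.map f) π) (nest B ι (Sᶜ.sort.map f) π)) =
    unshuffleSign S d • jacobiTerm B ι P π f S + unshuffleSign Sᶜ d • jacobiTerm B ι P π f Sᶜ := by
  have hS := hV.nest_pi_mem hf S
  have hSc := hV.nest_pi_mem hf Sᶜ
  have hleft : P (B (ι (P (nest B ι (S.sort.map f) π))) (nest B ι (Sᶜ.sort.map f) π)) =
      (∑ c ∈ S, d c).negOnePow • jacobiTerm B ι P π f S := by
    rw [hV.skew (hV.incl_mem (hV.proj_mem hS)) hSc, hV.jacobiTerm_eq hf S, map_neg,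
      LinearMap.map_smul_of_tower, smul_smul, ← Units.neg_smul, mul_add (-1 + _), mul_neg_one]
    simp [Int.negOnePow_add]
  have hright : P (B (nest B ι (S.sort.map f) π) (ι (P (nest B ι (Sᶜ.sort.map f) π)))) =
      (∑ c ∈ S, d c).negOnePow •
        ((∑ c ∈ S, d c) * ∑ c ∈ Sᶜ, d c).negOnePow • jacobiTerm B ι P π f Sᶜ := by
    rw [hV.jacobiTerm_eq hf Sᶜ, compl_compl, smul_smul, smul_smul, ← Int.negOnePow_add,
      ← Int.negOnePow_add, Int.negOnePow_even _ ⟨(∑ c ∈ S, d c) * ∑ c ∈ Sᶜ, d c, by ring⟩, one_smul]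
  rw [hV.proj_bracket hS hSc, hleft, hright, unshuffleSign_compl, ← smul_add, smul_smul,
    mul_assoc, Int.units_mul_self, mul_one, smul_add, smul_smul]

theorem sum_jacobiTerm {k : ℕ} {f : Fin (k + 1) → H} {d : Fin (k + 1) → ℤ}
    (hf : ∀ s, f s ∈ hr (d s)) :
    ∑ S, unshuffleSign S d • jacobiTerm B ι P π f S = 0 := by
  have hf₀ := hV.incl_mem (hf 0)
  have hsq := congrArg P (hV.nest_bracket (fun s => hf s.succ) hV.pi_mem
    (hV.bracket_mem hV.pi_mem hf₀))
  rw [hV.bracket_pi_bracket_pi hf₀, map_zero, map_zero, map_sum] at hsq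
  rw [sum_finset_fin_succ_compl, hsq]
  refine Finset.sum_congr rfl fun S _ => ?_
  rw [← hV.proj_bracket_nest_nest hf, LinearMap.map_smul_of_tower, unshuffleSign_map_succ,
    compl_map_succ, sort_insert_zero_map_succ, sort_map_succ, List.map_cons, nest_cons]
  simp only [Finset.sum_map, Fin.coe_succEmb, List.map_map, Function.comp_def, add_mul,
    neg_one_mul, Int.negOnePow_add, Int.negOnePow_neg, mul_left_comm, mul_comm]

end IsVData

end VData

section Functoriality

variable {K : Type u} [Field K]
variable {V : ℤ → Type v} [∀ i, AddCommGroup (V i)] [∀ i, Module K (V i)]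
variable {V' : ℤ → Type v'} [∀ i, AddCommGroup (V' i)] [∀ i, Module K (V' i)]
variable {W : ℤ → Type w} [∀ i, AddCommGroup (W i)] [∀ i, Module K (W i)]
variable {W' : ℤ → Type w'} [∀ i, AddCommGroup (W' i)] [∀ i, Module K (W' i)]

/-- The map `f ↦ ψ ∘ f ∘ (φ ⊗ ⋯ ⊗ φ)` on formal sums of multilinear maps; `cochainMap` is its
restriction to a given degree. -/
def famMap (φ : ∀ i, V' i →ₗ[K] V i) (ψ : ∀ i, W i →ₗ[K] W' i) : Fam K V W →ₗ[K] Fam K V' W' where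
  toFun f k := (DirectSum.lmap ψ).compMultilinearMap
    ((f k).compLinearMap fun _ => DirectSum.lmap φ)
  map_add' f g := funext fun k => MultilinearMap.ext fun a => by simp
  map_smul' c f := funext fun k => MultilinearMap.ext fun a => by simp

theorem lmap_diamond_self (θ : ∀ i, V' i →ₗ[K] V i) (n : ℤ) {φ' : Fam K V' V'} {φ : Fam K V V}
    (h : ∀ k a, DirectSum.lmap θ (φ' k a) = φ k fun t => DirectSum.lmap θ (a t)) (p : ℕ)
    (a : ℕ → Tot V') :
    DirectSum.lmap θ (evalSeq (diamond K V' n φ' φ') p a) =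
      evalSeq (diamond K V n φ φ) p (fun t => DirectSum.lmap θ (a t)) := by
  rw [evalSeq_diamond, evalSeq_diamond, map_sum]
  refine Finset.sum_congr rfl fun x _ => (h _ _).trans (congrArg (φ _) (funext fun t => ?_))
  simp only [insertSeq]
  split_ifs
  · exact lmap_koszul θ n _
  · exact h _ _
  · rfl

end Functoriality

section Shifting

variable {K : Type u} [Field K]
variable {V : ℤ → Type v} [∀ i, AddCommGroup (V i)] [∀ i, Module K (V i)]
variable {F : ℤ → Submodule K (Tot V)}

/-- The formal sums of maps that send `F d₁ × ⋯ × F d_k` to `F (d₁ + ⋯ + d_k + n)`. -/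
def shifting (F : ℤ → Submodule K (Tot V)) (n : ℤ) : Submodule K (Fam K V V) where
  carrier := {φ | ∀ (k : ℕ) (d : Fin (k + 1) → ℤ) (a : Fin (k + 1) → Tot V),
    (∀ i, a i ∈ F (d i)) → φ k a ∈ F ((∑ i, d i) + n)}
  add_mem' hφ hψ k d a ha := add_mem (hφ k d a ha) (hψ k d a ha)
  zero_mem' _ _ _ _ := zero_mem _
  smul_mem' c _ hφ k d a ha := Submodule.smul_mem _ c (hφ k d a ha)

theorem diamond_mem_shifting (hF : ∀ m j, ∀ a ∈ F j, koszul K V m a ∈ F j) (r : ℤ) {m n : ℤ}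
    {φ ψ : Fam K V V} (hφ : φ ∈ shifting F m) (hψ : ψ ∈ shifting F n) :
    diamond K V r φ ψ ∈ shifting F (m + n) := by
  intro p d a ha
  simp only [diamond, sum_apply]
  refine Submodule.sum_mem _ fun x _ => Submodule.sum_mem _ fun i _ => ?_
  have h := Finset.HasAntidiagonal.mem_antidiagonal.1 x.2
  set b : Fin (p + 1) → Tot V := fun t =>
    (if t.val < i.val then koszul K V r else LinearMap.id) (a t) with hb
  have hb_mem (t : Fin (p + 1)) : b t ∈ F (d t) := by
    rw [hb]
    dsimp only
    split_ifs
    · exact hF r _ _ (ha t)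
    · exact ha t
  rw [add_comm m n, ← add_assoc, ← sum_insertArgs h i n d]
  refine hφ x.1.1 _ (insertArgs h i (ψ x.1.2) b) fun j => ?_
  unfold insertArgs
  split_ifs
  · exact hb_mem _
  · exact hψ _ _ _ fun t => hb_mem _
  · exact hb_mem _

theorem famBracket_mem_shifting (hF : ∀ m j, ∀ a ∈ F j, koszul K V m a ∈ F j) (r s : ℤ) {m n : ℤ}
    {φ ψ : Fam K V V} (hφ : φ ∈ shifting F m) (hψ : ψ ∈ shifting F n) :
    famBracket r s φ ψ ∈ shifting F (m + n) :=
  sub_mem (diamond_mem_shifting hF _ hφ hψ)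
    (Submodule.smul_of_tower_mem _ _ (add_comm n m ▸ diamond_mem_shifting hF _ hψ hφ))

end Shifting

section Double

variable {K : Type u} [Field K]
variable {V : ℤ → Type v} [∀ i, AddCommGroup (V i)] [∀ i, Module K (V i)]

variable (K V) in
/-- The projection of `V̄ ⊕ V` onto `V̄`. -/
def fstTot : Tot (Double V) →ₗ[K] Tot V := DirectSum.lmap fun i => LinearMap.fst K (V i) (V i)

variable (K V) in
/-- The projection of `V̄ ⊕ V` onto `V`. -/
def sndTot : Tot (Double V) →ₗ[K] Tot V := DirectSum.lmap fun i => LinearMap.snd K (V i) (V i)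

variable (K V) in
/-- The inclusion of `V̄` in `V̄ ⊕ V`. -/
def inlTot : Tot V →ₗ[K] Tot (Double V) := DirectSum.lmap fun i => LinearMap.inl K (V i) (V i)

variable (K V) in
/-- The inclusion of `V` in `V̄ ⊕ V`. -/
def inrTot : Tot V →ₗ[K] Tot (Double V) := DirectSum.lmap fun i => LinearMap.inr K (V i) (V i)

variable (K V) in
/-- The map `(ā, x) ↦ x + a` from `V̄ ⊕ V` to `V`. -/
def addTot : Tot (Double V) →ₗ[K] Tot V :=
  DirectSum.lmap fun i => LinearMap.snd K (V i) (V i) + LinearMap.fst K (V i) (V i)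

theorem fstTot_inlTot (a : Tot V) : fstTot K V (inlTot K V a) = a :=
  DFinsupp.ext fun i => by simp [fstTot, inlTot, DirectSum.lmap_apply]

theorem sndTot_inlTot (a : Tot V) : sndTot K V (inlTot K V a) = 0 :=
  DFinsupp.ext fun i => by simp [sndTot, inlTot, DirectSum.lmap_apply]

theorem fstTot_inrTot (a : Tot V) : fstTot K V (inrTot K V a) = 0 :=
  DFinsupp.ext fun i => by simp [fstTot, inrTot, DirectSum.lmap_apply]

theorem sndTot_inrTot (a : Tot V) : sndTot K V (inrTot K V a) = a :=
  DFinsupp.ext fun i => by simp [sndTot, inrTot, DirectSum.lmap_apply]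

theorem inlTot_add_inrTot (x : Tot (Double V)) :
    inlTot K V (fstTot K V x) + inrTot K V (sndTot K V x) = x :=
  DFinsupp.ext fun i => by simp [fstTot, sndTot, inlTot, inrTot, DirectSum.lmap_apply]

theorem addTot_apply (x : Tot (Double V)) : addTot K V x = sndTot K V x + fstTot K V x :=
  DFinsupp.ext fun i => by simp [fstTot, sndTot, addTot, DirectSum.lmap_apply]

variable (K V) in
/-- Extension by zero of a map on `V̄`, followed by the inclusion of `V`. -/
def inclFam : Fam K V V →ₗ[K] Fam K (Double V) (Double V) :=
  famMap (fun i => LinearMap.fst K (V i) (V i)) (fun i => LinearMap.inr K (V i) (V i))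

variable (K V) in
/-- Restriction to `V̄`, followed by the projection to `V`. -/
def projFam : Fam K (Double V) (Double V) →ₗ[K] Fam K V V :=
  famMap (fun i => LinearMap.inl K (V i) (V i)) (fun i => LinearMap.snd K (V i) (V i))

theorem inclFam_apply (φ : Fam K V V) (k : ℕ) (a : Fin (k + 1) → Tot (Double V)) :
    inclFam K V φ k a = inrTot K V (φ k fun t => fstTot K V (a t)) := rfl

theorem projFam_apply (φ : Fam K (Double V) (Double V)) (k : ℕ) (a : Fin (k + 1) → Tot V) :
    projFam K V φ k a = sndTot K V (φ k fun t => inlTot K V (a t)) := rfl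

theorem projFam_inclFam (φ : Fam K V V) : projFam K V (inclFam K V φ) = φ := by
  refine funext fun k => MultilinearMap.ext fun a => ?_
  simp only [projFam_apply, inclFam_apply, fstTot_inlTot, sndTot_inrTot]

theorem diamond_inclFam_inclFam (n : ℤ) (φ ψ : Fam K V V) :
    diamond K (Double V) n (inclFam K V φ) (inclFam K V ψ) = 0 := by
  refine fam_ext fun p a => ?_
  rw [evalSeq_diamond]
  refine Finset.sum_eq_zero fun x hx => ?_
  have hi : x.2 < x.1.1 + 1 := by
    have := mem_insertions.1 hx
    omega
  rw [evalSeq, inclFam_apply, MultilinearMap.map_coord_zero _ ⟨x.2, hi⟩, map_zero]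
  simp [insertSeq, evalSeq, inclFam_apply, fstTot_inrTot]

theorem projFam_eq_zero_iff {φ : Fam K (Double V) (Double V)} :
    projFam K V φ = 0 ↔ φ ∈ shifting (fun _ => LinearMap.ker (sndTot K V)) 0 := by
  refine ⟨fun h k d a ha => ?_, fun h => funext fun k => MultilinearMap.ext fun a =>
    h k 0 _ fun i => sndTot_inlTot (a i)⟩
  have ha_inl (i : Fin (k + 1)) : a i = inlTot K V (fstTot K V (a i)) := by
    conv_lhs =>
      rw [← inlTot_add_inrTot (K := K) (a i), LinearMap.mem_ker.1 (ha i), map_zero, add_zero]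
  rw [funext ha_inl, LinearMap.mem_ker, ← projFam_apply, h]
  rfl

theorem projFam_famBracket_eq_zero (m n : ℤ) {φ ψ : Fam K (Double V) (Double V)}
    (hφ : projFam K V φ = 0) (hψ : projFam K V ψ = 0) : projFam K V (famBracket m n φ ψ) = 0 := by
  rw [projFam_eq_zero_iff] at hφ hψ ⊢
  refine famBracket_mem_shifting (fun r _ a ha => ?_) m n hφ hψ
  rw [LinearMap.mem_ker] at ha ⊢
  rw [sndTot, lmap_koszul, ← sndTot, ha, map_zero]

end Double

section DoubleFam

variable {K : Type u} [Field K]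
variable {V : ℤ → Type v} [∀ i, AddCommGroup (V i)] [∀ i, Module K (V i)]

theorem AInfinityStructure.diamond_self (A : AInfinityStructure K V) :
    diamond K V (-1) A.μ.1 A.μ.1 = 0 := by
  funext p
  refine multilinear_ext_homog fun d a ha => Eq.trans ?_ (A.relation p d a ha)
  simp only [diamond, sum_apply]
  refine Finset.sum_congr rfl fun x _ => Finset.sum_congr rfl fun i _ => ?_
  rw [MultilinearMap.compLinearMap_apply, Finset.sum_filter, negOnePow_sum, ← map_units_smul]
  refine congrArg _ (funext fun t => ?_)
  split_ifs
  · rw [koszul_of_mem_homog _ (ha t), neg_one_mul, Int.negOnePow_neg]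
  · rw [Int.negOnePow_zero, one_smul, LinearMap.id_apply]

theorem fstTot_doubleFam (μ : Fam K V V) (k : ℕ) (a : Fin (k + 1) → Tot (Double V)) :
    fstTot K V (doubleFam μ k a) = μ k fun t => fstTot K V (a t) := by
  change fstTot K V (inlTot K V _ + inrTot K V _) = _
  rw [map_add, fstTot_inlTot, fstTot_inrTot, add_zero]
  rfl

theorem addTot_doubleFam (μ : Fam K V V) (k : ℕ) (a : Fin (k + 1) → Tot (Double V)) :
    addTot K V (doubleFam μ k a) = μ k fun t => addTot K V (a t) := by
  have hempty : (Finset.univ.filter fun S : Finset (Fin (k + 1)) => ¬ S.Nonempty) = {∅} := by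
    ext S
    simp
  have hexpand := (μ k).map_add_univ (fun t => sndTot K V (a t)) (fun t => fstTot K V (a t))
  rw [← Finset.sum_filter_add_sum_filter_not Finset.univ Finset.Nonempty, hempty,
    Finset.sum_singleton, Finset.piecewise_empty] at hexpand
  simp only [addTot_apply, fstTot_doubleFam]
  refine Eq.trans (congrArg (· + _) ?_) hexpand.symm
  change sndTot K V (inlTot K V _ + inrTot K V _) = _
  rw [map_add, sndTot_inlTot, sndTot_inrTot, zero_add, sum_apply]
  refine Finset.sum_congr rfl fun S _ => congrArg (μ k) (funext fun t => ?_)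
  by_cases h : t ∈ S <;> simp [h, fstTot, sndTot]

theorem diamond_doubleFam (A : AInfinityStructure K V) :
    diamond K (Double V) (-1) (doubleFam A.μ.1) (doubleFam A.μ.1) = 0 := by
  refine fam_ext fun p a => ?_
  set z := evalSeq (diamond K (Double V) (-1) (doubleFam A.μ.1) (doubleFam A.μ.1)) p a with hz
  have hfst : fstTot K V z = 0 := by
    rw [hz, fstTot, lmap_diamond_self _ _ (fstTot_doubleFam A.μ.1), A.diamond_self]
    rfl
  have hadd : addTot K V z = 0 := by
    rw [hz, addTot, lmap_diamond_self _ _ (addTot_doubleFam A.μ.1), A.diamond_self]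
    rfl
  rw [addTot_apply, hfst, add_zero] at hadd
  rw [← inlTot_add_inrTot (K := K) z, hfst, hadd, map_zero, map_zero, add_zero]
  rfl

theorem projFam_doubleFam (μ : Fam K V V) : projFam K V (doubleFam μ) = 0 := by
  refine funext fun k => MultilinearMap.ext fun a => ?_
  have hadd := addTot_doubleFam μ k fun t => inlTot K V (a t)
  simp only [addTot_apply, fstTot_doubleFam, fstTot_inlTot, sndTot_inlTot, zero_add] at hadd
  exact add_eq_right.1 hadd

end DoubleFam

section Filtration

variable {K : Type u} [Field K]
variable {V : ℤ → Type v} [∀ i, AddCommGroup (V i)] [∀ i, Module K (V i)]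

variable (K V) in
/-- The increasing filtration `0 ⊆ V ⊆ V̄ ⊕ V`, with `V` in filtration degree `0`. -/
def doubleFiltration (j : ℤ) : Submodule K (Tot (Double V)) :=
  if j < 0 then ⊥ else if j = 0 then LinearMap.ker (fstTot K V) else ⊤

theorem doubleFiltration_of_neg {j : ℤ} (h : j < 0) : doubleFiltration K V j = ⊥ := if_pos h

theorem doubleFiltration_zero : doubleFiltration K V 0 = LinearMap.ker (fstTot K V) := by
  simp [doubleFiltration]

theorem doubleFiltration_of_pos {j : ℤ} (h : 0 < j) : doubleFiltration K V j = ⊤ := by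
  simp [doubleFiltration, h.not_gt, h.ne']

theorem koszul_mem_doubleFiltration (m j : ℤ) (a : Tot (Double V))
    (ha : a ∈ doubleFiltration K V j) : koszul K (Double V) m a ∈ doubleFiltration K V j := by
  rcases lt_trichotomy j 0 with h | rfl | h
  · rw [doubleFiltration_of_neg h, Submodule.mem_bot] at ha ⊢
    rw [ha, map_zero]
  · rw [doubleFiltration_zero, LinearMap.mem_ker] at ha ⊢
    rw [fstTot, lmap_koszul, ← fstTot, ha, map_zero]
  · rw [doubleFiltration_of_pos h]
    exact Submodule.mem_top

theorem mem_shifting_doubleFiltration {n : ℤ} {φ : Fam K (Double V) (Double V)}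
    (hzero : ∀ k a, fstTot K V (a 0) = 0 → φ k a ∈ doubleFiltration K V n)
    (hpos : ∀ k a s, 0 < s → φ k a ∈ doubleFiltration K V (s + n)) :
    φ ∈ shifting (doubleFiltration K V) n := by
  intro k d a ha
  by_cases hd : ∀ i, 0 ≤ d i
  · rcases (Finset.sum_nonneg fun i (_ : i ∈ Finset.univ) => hd i).eq_or_lt with h | h
    · have hd₀ := (Finset.sum_eq_zero_iff_of_nonneg fun i _ => hd i).1 h.symm 0 (Finset.mem_univ _)
      rw [← h, zero_add]
      refine hzero k a (LinearMap.mem_ker.1 ?_)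
      rw [← doubleFiltration_zero, ← hd₀]
      exact ha 0
    · exact hpos k a _ h
  · obtain ⟨i, hi⟩ := not_forall.1 hd
    have hai := ha i
    rw [doubleFiltration_of_neg (not_le.1 hi), Submodule.mem_bot] at hai
    rw [MultilinearMap.map_coord_zero _ i hai]
    exact zero_mem _

theorem doubleFam_mem_shifting (μ : Fam K V V) :
    doubleFam μ ∈ shifting (doubleFiltration K V) 0 := by
  refine mem_shifting_doubleFiltration (fun k a ha => ?_) fun k a s hs => ?_
  · rw [doubleFiltration_zero, LinearMap.mem_ker, fstTot_doubleFam]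
    exact MultilinearMap.map_coord_zero _ 0 ha
  · rw [add_zero, doubleFiltration_of_pos hs]
    exact Submodule.mem_top

theorem inclFam_mem_shifting (φ : Fam K V V) :
    inclFam K V φ ∈ shifting (doubleFiltration K V) (-1) := by
  refine mem_shifting_doubleFiltration (fun k a ha => ?_) fun k a s hs => ?_
  · rw [inclFam_apply, MultilinearMap.map_coord_zero _ 0 ha, map_zero]
    exact zero_mem _
  · rcases (show 0 ≤ s + -1 by omega).eq_or_lt with h | h
    · rw [← h, doubleFiltration_zero, LinearMap.mem_ker, inclFam_apply, fstTot_inrTot]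
    · rw [doubleFiltration_of_pos h]
      exact Submodule.mem_top

theorem projFam_eq_zero_of_mem_shifting {n : ℤ} {φ : Fam K (Double V) (Double V)}
    (hφ : φ ∈ shifting (doubleFiltration K V) n) {p : ℕ} (hp : (p : ℤ) + 1 + n < 0) :
    projFam K V φ p = 0 := by
  refine MultilinearMap.ext fun a => ?_
  have hmem := hφ p (fun _ => 1) (fun t => inlTot K V (a t)) fun i => by
    rw [doubleFiltration_of_pos one_pos]
    exact Submodule.mem_top
  rw [doubleFiltration_of_neg (by simpa using hp), Submodule.mem_bot] at hmem
  rw [projFam_apply, hmem, map_zero, zero_apply]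

end Filtration

section DerivedBrackets

variable {K : Type u} [Field K]
variable {V : ℤ → Type v} [∀ i, AddCommGroup (V i)] [∀ i, Module K (V i)]

variable (K V) in
/-- The inclusion of `ℋ` in `𝒢`, as a map between instances of `CochainTot`. -/
def totIncl : CochainTot K V →ₗ[K] CochainTot K (Double V) := incl K V

variable (K V) in
/-- The projection of `𝒢` onto `ℋ`, as a map between instances of `CochainTot`. -/
def totProj : CochainTot K (Double V) →ₗ[K] CochainTot K V := proj K V

/-- The element `π`, as an element of `CochainTot K (Double V)`. -/
def totPi (A : AInfinityStructure K V) : CochainTot K (Double V) := piElement A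

theorem totIncl_mem {n : ℤ} {f : CochainTot K V} (hf : f ∈ cochainGrading K V n) :
    totIncl K V f ∈ cochainGrading K (Double V) n :=
  lmap_mem_homog K _ hf

theorem totProj_mem {n : ℤ} {x : CochainTot K (Double V)}
    (hx : x ∈ cochainGrading K (Double V) n) : totProj K V x ∈ cochainGrading K V n :=
  lmap_mem_homog K _ hx

theorem totPi_mem (A : AInfinityStructure K V) : totPi A ∈ cochainGrading K (Double V) (-1) :=
  ⟨_, rfl⟩

theorem totIncl_lof (n : ℤ) (φ : cochain K V V n) :
    totIncl K V (DirectSum.lof K ℤ (fun r => cochain K V V r) n φ) =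
      DirectSum.lof K ℤ (fun r => cochain K (Double V) (Double V) r) n
        (cochainMap K (V := V) (V' := Double V) (W := V) (W' := Double V)
          (fun i => LinearMap.fst K (V i) (V i)) (fun i => LinearMap.inr K (V i) (V i)) n φ) :=
  DirectSum.lmap_lof _ _ _

theorem totProj_lof (n : ℤ) (φ : cochain K (Double V) (Double V) n) :
    totProj K V (DirectSum.lof K ℤ (fun r => cochain K (Double V) (Double V) r) n φ) =
      DirectSum.lof K ℤ (fun r => cochain K V V r) n
        (cochainMap K (V := Double V) (V' := V) (W := Double V) (W' := V)
          (fun i => LinearMap.inl K (V i) (V i)) (fun i => LinearMap.snd K (V i) (V i)) n φ) :=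
  DirectSum.lmap_lof _ _ _

theorem toFam_totIncl (f : CochainTot K V) :
    toFam K (Double V) (totIncl K V f) = inclFam K V (toFam K V f) := by
  have : toFam K (Double V) ∘ₗ totIncl K V = inclFam K V ∘ₗ toFam K V := by
    refine DirectSum.linearMap_ext K fun n => LinearMap.ext fun φ => ?_
    simp only [LinearMap.comp_apply, totIncl_lof, toFam_lof]
    rfl
  exact LinearMap.congr_fun this f

theorem toFam_totProj (x : CochainTot K (Double V)) :
    toFam K V (totProj K V x) = projFam K V (toFam K (Double V) x) := by
  have : toFam K V ∘ₗ totProj K V = projFam K V ∘ₗ toFam K (Double V) := by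
    refine DirectSum.linearMap_ext K fun n => LinearMap.ext fun φ => ?_
    simp only [LinearMap.comp_apply, totProj_lof, toFam_lof]
    rfl
  exact LinearMap.congr_fun this x

theorem toFam_totPi (A : AInfinityStructure K V) :
    toFam K (Double V) (totPi A) = doubleFam A.μ.1 :=
  toFam_lof _ _

theorem eq_zero_of_toFam_eq_zero {n : ℤ} {x : CochainTot K V} (hx : x ∈ cochainGrading K V n)
    (h : toFam K V x = 0) : x = 0 :=
  toFam_injOn n hx (zero_mem _) (h.trans (map_zero _).symm)

theorem totProj_totIncl (f : CochainTot K V) : totProj K V (totIncl K V f) = f := by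
  have : totProj K V ∘ₗ totIncl K V = LinearMap.id := by
    refine DirectSum.linearMap_ext K fun n => LinearMap.ext fun φ => ?_
    simp only [LinearMap.comp_apply, totIncl_lof, totProj_lof, LinearMap.id_apply]
    exact congrArg _ (Subtype.ext (projFam_inclFam φ.1))
  exact LinearMap.congr_fun this f

theorem isVData (A : AInfinityStructure K V) :
    IsVData (totBracket K (Double V)) (cochainGrading K (Double V)) (cochainGrading K V)
      (totIncl K V) (totProj K V) (totPi A) where
  bracket_mem := totBracket_mem
  skew := totBracket_skew
  jacobi := totBracket_jacobi
  incl_mem := totIncl_mem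
  proj_mem := totProj_mem
  proj_incl := totProj_totIncl
  bracket_incl_incl hf hg := by
    refine eq_zero_of_toFam_eq_zero (totBracket_mem (totIncl_mem hf) (totIncl_mem hg)) ?_
    rw [toFam_totBracket (totIncl_mem hf) (totIncl_mem hg), toFam_totIncl, toFam_totIncl,
      famBracket, diamondHom_apply, diamondHom_apply, diamond_inclFam_inclFam,
      diamond_inclFam_inclFam, smul_zero, sub_zero]
  proj_bracket_of_ker hx hy hPx hPy := by
    refine eq_zero_of_toFam_eq_zero (totProj_mem (totBracket_mem hx hy)) ?_
    rw [toFam_totProj, toFam_totBracket hx hy]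
    refine projFam_famBracket_eq_zero _ _ ?_ ?_
    · rw [← toFam_totProj, hPx, map_zero]
    · rw [← toFam_totProj, hPy, map_zero]
  pi_mem := totPi_mem A
  proj_pi := by
    refine eq_zero_of_toFam_eq_zero (totProj_mem (totPi_mem A)) ?_
    rw [toFam_totProj, toFam_totPi, projFam_doubleFam]
  bracket_pi_bracket_pi hy := by
    have hπy := totBracket_mem (totPi_mem A) hy
    refine eq_zero_of_toFam_eq_zero (totBracket_mem (totPi_mem A) hπy) ?_
    rw [toFam_totBracket (totPi_mem A) hπy, toFam_totBracket (totPi_mem A) hy, toFam_totPi]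
    exact famBracket_famBracket_eq_zero (by decide) (doubleFam_mem A.μ.2) (toFam_mem hy)
      (diamond_doubleFam A)

/-- The iterated bracket `[⋯[[π, f₁], f₂], ⋯, f_k]` as a multilinear map. -/
def iterMultilinear (A : AInfinityStructure K V) : ∀ k : ℕ,
    MultilinearMap K (fun _ : Fin k => CochainTot K V) (CochainTot K (Double V))
  | 0 => MultilinearMap.constOfIsEmpty K _ (totPi A)
  | k + 1 => MultilinearMap.uncurryRight
      (((totBracket K (Double V)).compl₂ (totIncl K V)).compMultilinearMap (iterMultilinear A k))

theorem iterMultilinear_succ (A : AInfinityStructure K V) (k : ℕ)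
    (f : Fin (k + 1) → CochainTot K V) :
    iterMultilinear A (k + 1) f = totBracket K (Double V)
      (iterMultilinear A k fun i => f i.castSucc) (totIncl K V (f (Fin.last k))) := rfl

theorem iterMultilinear_eq_iterBracket (A : AInfinityStructure K V) (k : ℕ)
    (f : Fin k → CochainTot K V) : iterMultilinear A k f = iterBracket A k f := by
  induction k with
  | zero => rfl
  | succ k ih =>
    rw [iterMultilinear_succ, ih]
    rfl

theorem iterMultilinear_eq_nest (A : AInfinityStructure K V) (k : ℕ)
    (f : Fin k → CochainTot K V) :
    iterMultilinear A k f =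
      nest (totBracket K (Double V)) (totIncl K V) (List.ofFn f) (totPi A) := by
  induction k with
  | zero => rfl
  | succ k ih =>
    rw [iterMultilinear_succ, ih, List.ofFn_succ', List.concat_eq_append, nest_concat]

theorem iterMultilinear_mem (A : AInfinityStructure K V) {k : ℕ} {f : Fin k → CochainTot K V}
    {d : Fin k → ℤ} (hf : ∀ s, f s ∈ cochainGrading K V (d s)) :
    iterMultilinear A k f ∈ cochainGrading K (Double V) (-1 + ∑ s, d s) := by
  induction k with
  | zero => exact totPi_mem A
  | succ k ih =>
    rw [Fin.sum_univ_castSucc, ← add_assoc, iterMultilinear_succ]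
    exact totBracket_mem (ih fun s => hf s.castSucc) (totIncl_mem (hf (Fin.last k)))

/-- The higher derived brackets on `ℋ`. -/
def derivedBrackets (A : AInfinityStructure K V) :
    Fam K (fun r : ℤ => cochain K V V r) (fun r : ℤ => cochain K V V r) := fun k =>
  (totProj K V).compMultilinearMap (iterMultilinear A (k + 1))

theorem derivedBrackets_eq_proj_iterBracket (A : AInfinityStructure K V) (k : ℕ)
    (f : Fin (k + 1) → HSpace K V) : derivedBrackets A k f = proj K V (iterBracket A (k + 1) f) :=
  congrArg (totProj K V) (iterMultilinear_eq_iterBracket A (k + 1) f)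

theorem derivedBrackets_apply (A : AInfinityStructure K V) (k : ℕ)
    (f : Fin (k + 1) → CochainTot K V) : derivedBrackets A k f =
      totProj K V (nest (totBracket K (Double V)) (totIncl K V) (List.ofFn f) (totPi A)) :=
  congrArg (totProj K V) (iterMultilinear_eq_nest A (k + 1) f)

theorem insertMap_derivedBrackets (A : AInfinityStructure K V) {k i p : ℕ} (h : k + i = p)
    {σ : Equiv.Perm (Fin (p + 1))} (hσ : IsShuffle (i + 1) σ) (f : Fin (p + 1) → CochainTot K V) :
    insertMap h 0 (derivedBrackets A k) (derivedBrackets A i) (fun s => f (σ s)) =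
      jacobiTerm (totBracket K (Double V)) (totIncl K V) (totProj K V) (totPi A) f
        (firstBlock (i + 1) σ) := by
  have hfirst := hσ.ofFn_first (show i + 1 ≤ p + 1 by omega)
  have hsecond := hσ.ofFn_second (show i + 1 + k = p + 1 by omega)
  rw [insertMap_apply, derivedBrackets_apply, List.ofFn_succ, jacobiTerm, ← hfirst, ← hsecond,
    List.map_ofFn, List.map_ofFn]
  simp only [insertArgs, lt_irrefl, if_false, if_true, Fin.not_lt_zero, Fin.succ_ne_zero,
    derivedBrackets_apply, Fin.val_zero, zero_add, Fin.val_succ, Function.comp_def,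
    add_right_comm _ 1, add_comm _ i, add_assoc]

open Classical in
theorem derivedBrackets_jacobi (A : AInfinityStructure K V) {p : ℕ} {d : Fin (p + 1) → ℤ}
    {f : Fin (p + 1) → CochainTot K V} (hf : ∀ s, f s ∈ cochainGrading K V (d s)) :
    ∑ y : Finset.HasAntidiagonal.antidiagonal p,
      ∑ σ : Equiv.Perm (Fin (p + 1)) with IsShuffle (y.1.2 + 1) σ, koszulSign σ d •
        insertMap (Finset.HasAntidiagonal.mem_antidiagonal.1 y.2) 0 (derivedBrackets A y.1.1)
          (derivedBrackets A y.1.2) (fun s => f (σ s)) = 0 := by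
  have hsum := (isVData A).sum_jacobiTerm hf
  rw [← sum_antidiagonal_isShuffle p _ (by rw [(isVData A).jacobiTerm_empty, smul_zero]),
    ← Finset.sum_coe_sort] at hsum
  refine Eq.trans (Finset.sum_congr rfl fun y _ => Finset.sum_congr rfl fun σ hσ => ?_) hsum
  have hσ := (Finset.mem_filter.1 hσ).2
  rw [insertMap_derivedBrackets A _ hσ, hσ.koszulSign_eq]

theorem isLInfinityAlgebra_derivedBrackets (A : AInfinityStructure K V) :
    IsLInfinityAlgebra K (fun r : ℤ => cochain K V V r) (derivedBrackets A) where
  degree _ _ _ hf := by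
    rw [add_comm]
    exact totProj_mem (iterMultilinear_mem A hf)
  symmetric k σ _ _ hf := by
    rw [derivedBrackets_apply, derivedBrackets_apply,
      (isVData A).nest_ofFn_perm σ hf (totPi_mem A), LinearMap.map_smul_of_tower]
  jacobi _ _ _ hf := derivedBrackets_jacobi A hf

theorem toFam_iterMultilinear_mem_shifting (A : AInfinityStructure K V) {k : ℕ}
    {f : Fin k → CochainTot K V} {d : Fin k → ℤ} (hf : ∀ s, f s ∈ cochainGrading K V (d s)) :
    toFam K (Double V) (iterMultilinear A k f) ∈ shifting (doubleFiltration K V) (-k) := by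
  induction k with
  | zero =>
    rw [Nat.cast_zero, neg_zero]
    exact (toFam_totPi A).symm ▸ doubleFam_mem_shifting A.μ.1
  | succ k ih =>
    rw [iterMultilinear_succ, toFam_totBracket (iterMultilinear_mem A fun s => hf s.castSucc)
      (totIncl_mem (hf (Fin.last k))), toFam_totIncl, Nat.cast_succ, neg_add]
    exact famBracket_mem_shifting koszul_mem_doubleFiltration _ _ (ih fun s => hf s.castSucc)
      (inclFam_mem_shifting _)

theorem apply_eq_zero_of_toFam {m : ℤ} {x : CochainTot K V} (hx : x ∈ cochainGrading K V m)
    {p : ℕ} (h : toFam K V x p = 0) (n : ℤ) : (x n : Fam K V V) p = 0 := by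
  obtain ⟨φ, rfl⟩ := hx
  rw [toFam_lof] at h
  rcases eq_or_ne n m with rfl | hn
  · rwa [DirectSum.lof_apply]
  · rw [DirectSum.lof_eq_of, DirectSum.of_eq_of_ne _ _ _ hn]
    rfl

theorem derivedBrackets_apply_eq_zero (A : AInfinityStructure K V) {k p : ℕ} (hp : p < k)
    (f : Fin (k + 1) → CochainTot K V) (n : ℤ) : (derivedBrackets A k f n : Fam K V V) p = 0 := by
  let component : CochainTot K V →ₗ[K] MultilinearMap K (fun _ : Fin (p + 1) => Tot V) (Tot V) :=
    LinearMap.proj p ∘ₗ (cochain K V V n).subtype ∘ₗ DirectSum.component K ℤ _ n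
  have : component.compMultilinearMap (derivedBrackets A k) = 0 := by
    refine multilinear_ext_homog fun d f hf => ?_
    refine apply_eq_zero_of_toFam (totProj_mem (iterMultilinear_mem A hf)) ?_ n
    rw [toFam_totProj]
    exact projFam_eq_zero_of_mem_shifting (toFam_iterMultilinear_mem_shifting A hf)
      (by push_cast; omega)
  exact congrArg (fun g => g f) this

end DerivedBrackets

end DiffAInf

theorem theorem4p4_general {K : Type*} [Field K]
    (V : ℤ → Type*) [∀ i, AddCommGroup (V i)] [∀ i, Module K (V i)]
    (A : DiffAInf.AInfinityStructure K V) :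
    ∃ l : DiffAInf.Fam K (fun n : ℤ => DiffAInf.cochain K V V n)
        (fun n : ℤ => DiffAInf.cochain K V V n),
      DiffAInf.IsLInfinityAlgebra K (fun n : ℤ => DiffAInf.cochain K V V n) l ∧
      (∀ (k : ℕ) (f : Fin (k + 1) → DiffAInf.HSpace K V),
        l k f = DiffAInf.proj K V (DiffAInf.iterBracket A (k + 1) f)) ∧
      (∀ (k : ℕ) (f : Fin (k + 1) → DiffAInf.HSpace K V) (n : ℤ) (p : ℕ), p < k →
        (l k f n : DiffAInf.Fam K V V) p = 0) :=
  ⟨DiffAInf.derivedBrackets A, DiffAInf.isLInfinityAlgebra_derivedBrackets A,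
    DiffAInf.derivedBrackets_eq_proj_iterBracket A,
    fun _ f n _ hp => DiffAInf.derivedBrackets_apply_eq_zero A hp f n⟩

theorem theorem4p4 {K : Type*} [Field K] [CharZero K]
    (V : ℤ → Type*) [∀ i, AddCommGroup (V i)] [∀ i, Module K (V i)]
    (A : DiffAInf.AInfinityStructure K V) :
    ∃ l : DiffAInf.Fam K (fun n : ℤ => DiffAInf.cochain K V V n)
        (fun n : ℤ => DiffAInf.cochain K V V n),
      DiffAInf.IsLInfinityAlgebra K (fun n : ℤ => DiffAInf.cochain K V V n) l ∧
      (∀ (k : ℕ) (f : Fin (k + 1) → DiffAInf.HSpace K V),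
        l k f = DiffAInf.proj K V (DiffAInf.iterBracket A (k + 1) f)) ∧
      (∀ (k : ℕ) (f : Fin (k + 1) → DiffAInf.HSpace K V) (n : ℤ) (p : ℕ), p < k →
        (l k f n : DiffAInf.Fam K V V) p = 0) := by
  exact theorem4p4_general V A
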